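/- Let $\mathcal S$ be the group of finitely supported permutations of $\{0,1,2,\dots\}$ and let $\mathbb C[\mathcal S]$ be its group algebra with the canonical trace $\sum_\sigma x_\sigma\,\sigma\mapsto x_{\mathrm{id}}$. For integers $r\ge 1$, $n\ge1$ put $$M_r(n)=\frac1{n^{r/2}}\sum (0\,a_1\,a_2\cdots a_r)\in\mathbb C[\mathcal S],$$ the sum running over all $r$-tuples $(a_1,\dots,a_r)$ of pairwise distinct integers of $[1,n]$ (this is $M_r(n,t)$, where the $a_i$ range over the integers of $[1,nt]$, at $t=1$). A noncommutative probability space is a complex unital $*$-algebra $A$ with a linear form $\varphi$ such that $\varphi(1)=1$, $\varphi(x^*)=\overline{\varphi(x)}$ and $\varphi(xx^*)\ge0$ for all $x\in A$. The (noncommutative) distribution of a family of elements of $A$ is the map sending a noncommutative polynomial to the value of $\varphi$ at that polynomial evaluated at the family; convergence in distribution is pointwise convergence of these maps. For $p\ge1$ and a vector $r=(r_1,\dots,r_p)$ of positive integers let $|r|=r_1+\dots+r_p$, and let $\hat 1_r$ be the partition of $\{1,\dots,|r|\}$ into successive intervals of lengths $r_1,\dots,r_p$. Let $NC_2(r)$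 be the set of noncrossing pairings $\pi$ of $\{1,\dots,|r|\}$ such that $\pi\wedge\hat1_r$ is the partition into singletons (i.e. $\pi$ pairs no two points in the same block of $\hat 1_r$), and let $NC_2^*(r)$ be the set of those $\pi\in NC_2(r)$ for which $\pi\vee\hat1_r$ is the one-block partition. Let $\kappa_p$ denote the free cumulants with respect to $\varphi$, determined by $\varphi(a_1\cdots a_p)=\sum_{\pi\in NC(p)}\prod_{V\in\pi}\kappa_{|V|}\big((a_i)_{i\in V}\big)$ for all $p\ge1$, where $NC(p)$ is the set of noncrossing partitions of $\{1,\dots,p\}$ and the elements of each block $V$ are taken in increasing order. **Theorem.** As $n\to\infty$, the family $(M_r(n))_{r\ge1}$ converges in distribution to a family $(M_r)_{r\ge1}$ of self-adjoint elements of some noncommutative probability space. The limit distribution is characterized by its mixed moments, and also by its free cumulants, as follows. For every family $(M_r)_{r\ge1}$ of self-adjoint elements of a noncommutative probability space $(A,\varphi)$, the following are equivalent: 1. $(M_r(n))_{r\ge1}$ converges in distribution to $(M_r)_{r\ge1}$ as $n\to\infty$; 2. $\varphi(M_{r_1}M_{r_2}\cdots M_{r_p})=\#NC_2(r)$ for all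 $p\ge1$ and all vectors $r=(r_1,\dots,r_p)$ of positive integers; 3. $\kappa_p(M_{r_1},M_{r_2},\dots,M_{r_p})=\#NC_2^*(r)$ for all $p\ge1$ and all vectors $r=(r_1,\dots,r_p)$ of positive integers. -/

import Mathlib

open Filter Topology
open scoped ComplexOrder

/-! ### Noncommutative probability spaces and distributions -/

/-- A linear form `φ` on a complex unital `*`-algebra `A` making `(A, φ)` a noncommutative
probability space. -/
structure IsState {A : Type*} [Ring A] [StarRing A] [Algebra ℂ A] [StarModule ℂ A]
    (φ : A →ₗ[ℂ] ℂ) : Prop where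
  map_one : φ 1 = 1
  map_star : ∀ x : A, φ (star x) = (starRingEnd ℂ) (φ x)
  nonneg : ∀ x : A, 0 ≤ φ (x * star x)

/-- The noncommutative distribution of a family `x` with respect to a linear form `φ`: it maps a
noncommutative polynomial `P` in the variables `X i` to `φ (P (x))`. -/
noncomputable def ncDistribution {A : Type*} [Ring A] [Algebra ℂ A] {I : Type*}
    (φ : A →ₗ[ℂ] ℂ) (x : I → A) : FreeAlgebra ℂ I →ₗ[ℂ] ℂ :=
  φ ∘ₗ (FreeAlgebra.lift ℂ x).toLinearMap

/-- Convergence in noncommutative distribution of the families `x n` (in `(B, ψ)`), as `n` tends to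
infinity, to the family `y` (in `(A, φ)`): pointwise convergence of the distributions on all
noncommutative polynomials. -/
def ConvergesInDistribution {A B : Type*} [Ring A] [Algebra ℂ A] [Ring B] [Algebra ℂ B]
    {I : Type*} (ψ : B →ₗ[ℂ] ℂ) (x : ℕ → I → B) (φ : A →ₗ[ℂ] ℂ) (y : I → A) : Prop :=
  ∀ P : FreeAlgebra ℂ I,
    Tendsto (fun n => ncDistribution ψ (x n) P) atTop (𝓝 (ncDistribution φ y P))

/-! ### The permutation model -/

/-- The group of finitely supported permutations of the set of nonnegative integers. -/
def FinitaryPerm : Subgroup (Equiv.Perm ℕ) where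
  carrier := {σ | {x | σ x ≠ x}.Finite}
  mul_mem' := by
    intro σ τ hσ hτ
    refine (Set.Finite.union hσ hτ).subset ?_
    intro x hx
    by_contra h
    simp only [Set.mem_union, Set.mem_ofPred_eq, not_or, not_not] at h
    exact hx (by rw [Equiv.Perm.mul_apply, h.2, h.1])
  one_mem' := by simp
  inv_mem' := by
    intro σ hσ
    refine Set.Finite.subset hσ ?_
    intro x hx h
    exact hx (by rw [Equiv.Perm.inv_eq_iff_eq]; exact h.symm)

/-- The canonical trace on the group algebra of a group `G`: the coefficient of the neutral
element. -/
noncomputable def groupTrace (G : Type*) [Group G] : MonoidAlgebra ℂ G →ₗ[ℂ] ℂ where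
  toFun x := x.coeff 1
  map_add' _ _ := by simp
  map_smul' _ _ := by simp

/-- The cycle `0 → a 0 → a 1 → ⋯ → a (r - 1) → 0` (for distinct nonzero `a i`). -/
def zeroCycle {r : ℕ} (a : Fin r → ℕ) : FinitaryPerm :=
  ⟨List.formPerm (0 :: List.ofFn a),
    (Finset.finite_toSet _).subset (List.support_formPerm_le' (0 :: List.ofFn a))⟩

/-- The element `M_r(n, t) = n ^ (-r / 2) * ∑ (0 a₁ a₂ ⋯ a_r)` of the group algebra, the sum being
over the `r`-tuples of pairwise distinct integers of `[1, n t]`. -/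
noncomputable def permModel (r n : ℕ) (t : ℝ) : MonoidAlgebra ℂ FinitaryPerm :=
  (((n : ℝ) ^ (-(r : ℝ) / 2) : ℝ) : ℂ) •
    ∑ a : Fin r ↪ Finset.Icc 1 ⌊(n : ℝ) * t⌋₊,
      MonoidAlgebra.of ℂ FinitaryPerm (zeroCycle fun i => (a i : ℕ))

/-- The family `M` (indexed by the integers `r ≥ 1`) in `(A, φ)` has the limit distribution, as
`n` tends to infinity, of the families `(M_r(n, 1))` for `r ≥ 1`. -/
def IsLimitFamily {A : Type*} [Ring A] [Algebra ℂ A] (φ : A →ₗ[ℂ] ℂ) (M : ℕ+ → A) : Prop :=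
  ConvergesInDistribution (groupTrace FinitaryPerm) (fun n (r : ℕ+) => permModel r n 1) φ M

/-! ### Noncrossing partitions and pairings

Partitions are encoded by equivalence relations, with the usual refinement order: `⊥` is the
partition into singletons, `⊤` the one-block partition, `⊓` and `⊔` are meet and join. -/

/-- Noncrossing partitions of a linearly ordered set. -/
def Setoid.IsNoncrossing {α : Type*} [LinearOrder α] (π : Setoid α) : Prop :=
  ∀ a b c d : α, a < b → b < c → c < d → π a c → π b d → π a b

/-- A pairing is a partition all of whose blocks have exactly two elements. -/
def Setoid.IsPairing {α : Type*} (π : Setoid α) : Prop :=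
  ∀ a : α, {b | π a b}.ncard = 2

/-- The function `f_r` which maps the elements of the `k`-th of the `p` successive intervals of
lengths `r 0, r 1, …` of `{0, …, |r| - 1}`, where `|r| = ∑ i, r i`, to `k`. -/
def blockIndex {p : ℕ} (r : Fin p → ℕ+) (x : Fin (∑ i, (r i : ℕ))) : Fin p :=
  (finSigmaFinEquiv.symm x).1

/-- The partition of `{0, …, |r| - 1}` into successive intervals of lengths `r 0, r 1, …`. -/
def blockPartition {p : ℕ} (r : Fin p → ℕ+) : Setoid (Fin (∑ i, (r i : ℕ))) :=
  Setoid.ker (blockIndex r)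

/-- The noncrossing pairings which do not link two elements of the same block of
`blockPartition r`. -/
def NC2 {p : ℕ} (r : Fin p → ℕ+) : Set (Setoid (Fin (∑ i, (r i : ℕ)))) :=
  {π | π.IsNoncrossing ∧ π.IsPairing ∧ π ⊓ blockPartition r = ⊥}

/-- The elements of `NC2 r` which moreover connect all the blocks of `blockPartition r`. -/
def NC2Star {p : ℕ} (r : Fin p → ℕ+) : Set (Setoid (Fin (∑ i, (r i : ℕ)))) :=
  {π | π ∈ NC2 r ∧ π ⊔ blockPartition r = ⊤}

/-! ### Free cumulants -/

noncomputable instance {n : ℕ} : Fintype (Setoid (Fin n)) :=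
  have : Finite (Setoid (Fin n)) :=
    Finite.of_injective (fun (π : Setoid (Fin n)) (a b : Fin n) => π a b) (by
      intro π ρ h
      ext a b
      exact iff_of_eq (congrFun (congrFun h a) b))
  Fintype.ofFinite _

open Classical in
/-- A block of a partition of `{0, …, n - 1}`, as a finite set. -/
noncomputable def partitionBlock {n : ℕ} (π : Setoid (Fin n)) (q : Quotient π) : Finset (Fin n) :=
  Finset.univ.filter fun i => Quotient.mk π i = q

theorem card_partitionBlock_lt {n : ℕ} {π : Setoid (Fin n)} (hπ : π ≠ ⊤) (q : Quotient π) :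
    (partitionBlock π q).card < n := by
  have h : (partitionBlock π q).card < (Finset.univ : Finset (Fin n)).card := by
    refine Finset.card_lt_card (Finset.ssubset_univ_iff.mpr fun hq => hπ ?_)
    have hall : ∀ i, Quotient.mk π i = q := fun i => by
      have := Finset.mem_univ i
      rw [← hq] at this
      simpa [partitionBlock] using this
    refine Setoid.ext fun a b => ⟨fun _ => trivial, fun _ => ?_⟩
    exact Quotient.exact ((hall a).trans (hall b).symm)
  simpa using h

open Classical in
/-- The free cumulants `κ_n (a_1, …, a_n)` with respect to `φ`, defined by the recursive form of the
moment-cumulant formula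
`φ (a_1 ⋯ a_n) = ∑_{π ∈ NC(n)} ∏_{V ∈ π} κ_{|V|} (a_i, i ∈ V)`,
where the elements of each block `V` are listed in increasing order. -/
noncomputable def freeCumulant {A : Type*} [Ring A] [Algebra ℂ A] (φ : A →ₗ[ℂ] ℂ)
    (n : ℕ) (a : Fin n → A) : ℂ :=
  φ (List.ofFn a).prod -
    ∑ π : {π : Setoid (Fin n) // π.IsNoncrossing ∧ π ≠ ⊤}, ∏ q : Quotient π.1,
      freeCumulant φ (partitionBlock π.1 q).card
        (fun i => a ((partitionBlock π.1 q).orderEmbOfFin rfl i))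
termination_by n
decreasing_by exact card_partitionBlock_lt π.2.2 q

/-!
A cycle factors into star transpositions, `(0 a₁ ⋯ a_r) = (0 a_r) ⋯ (0 a₁)`, so after reversing the
tuples `M_r(n)` is, up to the factor `n ^ (-r / 2)`, the sum of the products `(0 a₁) ⋯ (0 a_r)`.
Consequently the trace of `M_{r₁}(n) ⋯ M_{r_p}(n)` is `n ^ (-|r| / 2)` times the number of words of
length `|r|` over `[1, n]`, without repetition inside the `p` successive intervals, for which the
product of the transpositions `(0 a_k)` is trivial (`groupTrace_prod_permModel`).

These words are sorted according to the partition of the positions into classes of equal letters.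
There are `n (n - 1) ⋯ (n - k + 1)` words with a given partition into `k` classes. A letter which
occurs only once is moved by the product (`prod_swap_ne_one`), so all classes have at least two
elements; partitions with a class of at least three elements are then negligible, and a pairing
contributes `1` in the limit or nothing. Whether the product is trivial for a pairing is decided by
`prod_swap_eq_one_iff`: noncrossing pairings are exactly those which work. If the pairing is
noncrossing, the interval between two equal letters is closed under taking partners and everything
cancels inductively. Conversely, following the point `0` while the letters act one after the other,
starting just after the first occurrence of a letter, one can only jump over complete pairs until
the second occurrence of that letter; hence the interval between two equal letters is closed under
taking partners, which means noncrossing. This gives the limit of the mixed moments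
(`tendsto_groupTrace_prod_permModel`), and convergence of all mixed moments is convergence in
distribution.

For the cumulants, the join of a noncrossing pairing with the partition into intervals is
noncrossing (`Setoid.IsNoncrossing.sup_ker`), hence comes from a noncrossing partition `π` of the set
of intervals. The pairings with a given `π` correspond to families of connected noncrossing
pairings, one for each block of `π` (`bijOn_glue`). So the numbers of all pairings and of connected
ones satisfy the moment-cumulant formula (`ncard_NC2_eq`), which determines the cumulants from the
moments and conversely.

The limit exists as a state on the algebra of noncommutative polynomials in self-adjoint variables:
it is the pointwise limit of the states obtained by evaluating the polynomials at the self-adjoint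
family `(M_r(n))` and taking the trace (`isState_limitState`).
-/

/-! ### Products of star transpositions -/

/-- The product of the transpositions `(0 w_k)` over `i ≤ k < j`, in increasing order of `k`. -/
def starProd (w : ℕ → ℕ) (i j : ℕ) : Equiv.Perm ℕ :=
  ((List.Ico i j).map fun k => Equiv.swap 0 (w k)).prod

theorem starProd_self (w : ℕ → ℕ) (i : ℕ) : starProd w i i = 1 := by simp [starProd]

theorem starProd_of_lt (w : ℕ → ℕ) {i j : ℕ} (h : i < j) :
    starProd w i j = Equiv.swap 0 (w i) * starProd w (i + 1) j := by
  simp [starProd, List.Ico.eq_cons h]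

theorem starProd_mul_starProd (w : ℕ → ℕ) {i j k : ℕ} (hij : i ≤ j) (hjk : j ≤ k) :
    starProd w i j * starProd w j k = starProd w i k := by
  simp [starProd, ← List.Ico.append_consecutive hij hjk]

theorem starProd_apply_of_ne (w : ℕ → ℕ) {i j b : ℕ} (hb : b ≠ 0)
    (h : ∀ k, i ≤ k → k < j → w k ≠ b) : starProd w i j b = b := by
  rcases le_total j i with hji | hij
  · simp [starProd, List.Ico.eq_nil_of_le hji]
  induction hij using Nat.decreasingInduction with
  | self => simp [starProd_self]
  | of_succ k hk ih =>
    rw [starProd_of_lt w hk, Equiv.Perm.mul_apply, ih fun l hl => h l (by omega),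
      Equiv.swap_apply_of_ne_of_ne hb (h k le_rfl hk).symm]

/-- The inverse permutation `(starProd w i j)⁻¹` lets the letters `w i, w (i + 1), …` act from the
first to the last. -/
theorem starProd_inv_apply_of_lt (w : ℕ → ℕ) {i j : ℕ} (h : i < j) (x : ℕ) :
    (starProd w i j)⁻¹ x = (starProd w (i + 1) j)⁻¹ (Equiv.swap 0 (w i) x) := by
  rw [starProd_of_lt w h, mul_inv_rev, Equiv.Perm.mul_apply, Equiv.swap_inv]

theorem starProd_inv_apply_of_ne (w : ℕ → ℕ) {i j k b : ℕ} (hij : i ≤ j) (hjk : j ≤ k) (hb : b ≠ 0)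
    (h : ∀ l, i ≤ l → l < j → w l ≠ b) : (starProd w i k)⁻¹ b = (starProd w j k)⁻¹ b := by
  rw [← starProd_mul_starProd w hij hjk, mul_inv_rev, Equiv.Perm.mul_apply]
  congr 1
  rw [Equiv.Perm.inv_eq_iff_eq, starProd_apply_of_ne w hb h]

/-- Words of length `m` over the positive integers in which each letter occurs exactly twice, the
other occurrence of the `k`-th letter being at position `s k`. -/
structure IsPairedWord (w : ℕ → ℕ) (m : ℕ) (s : ℕ → ℕ) : Prop where
  ne_zero : ∀ k < m, w k ≠ 0
  lt : ∀ k < m, s k < m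
  ne : ∀ k < m, s k ≠ k
  map : ∀ k < m, w (s k) = w k
  invol : ∀ k < m, s (s k) = k
  eq_or : ∀ k < m, ∀ l < m, w l = w k → l = k ∨ l = s k

namespace IsPairedWord

variable {w s : ℕ → ℕ} {m : ℕ}

/-- In a noncrossing paired word, a letter and its partner cut a partner-closed interval into two
shorter ones, so that everything cancels. -/
theorem starProd_eq_one (hw : IsPairedWord w m s)
    (hnc : ∀ a b c d, a < b → b < c → c < d → d < m → w a = w c → w b = w d → w a = w b)
    (i j : ℕ) (hj : j ≤ m) (hc : ∀ k, i ≤ k → k < j → i ≤ s k ∧ s k < j) :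
    starProd w i j = 1 := by
  induction hd : j - i using Nat.strong_induction_on generalizing i j with
  | _ d ih =>
  rcases le_or_gt j i with hji | hij
  · simp [starProd, List.Ico.eq_nil_of_le hji]
  obtain ⟨hk1, hk2⟩ := hc i le_rfl hij
  have him : i < m := by omega
  have hne := hw.ne i him
  have hwk := hw.map i him
  have hss := hw.invol i him
  set k := s i with hk
  have hik : i < k := by omega
  have hkm : k < m := by omega
  have h1 : starProd w (i + 1) k = 1 := by
    refine ih (k - (i + 1)) (by omega) _ _ (by omega) (fun l hl1 hl2 => ?_) rfl
    obtain ⟨h1, h2⟩ := hc l (by omega) (by omega)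
    have hlm : l < m := by omega
    have hsl := hw.invol l hlm
    have hi : s l ≠ i := fun h => by rw [h] at hsl; omega
    have hk' : s l ≠ k := fun h => by rw [h] at hsl; omega
    refine ⟨by omega, ?_⟩
    by_contra hlt
    have := hnc i l k (s l) (by omega) hl2 (by omega) (by omega) hwk.symm (hw.map l hlm).symm
    rcases hw.eq_or i him l hlm this.symm with h | h <;> omega
  have h2 : starProd w (k + 1) j = 1 := by
    refine ih (j - (k + 1)) (by omega) _ _ (by omega) (fun l hl1 hl2 => ?_) rfl
    obtain ⟨h1, h2⟩ := hc l (by omega) (by omega)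
    have hlm : l < m := by omega
    have hsl := hw.invol l hlm
    have hi : s l ≠ i := fun h => by rw [h] at hsl; omega
    have hk' : s l ≠ k := fun h => by rw [h] at hsl; omega
    refine ⟨?_, by omega⟩
    by_contra hlt
    have := hnc i (s l) k l (by omega) (by omega) (by omega) hlm hwk.symm (hw.map l hlm)
    rcases hw.eq_or i him (s l) (by omega) this.symm with h | h <;> omega
  rw [starProd_of_lt w hij, ← starProd_mul_starProd w (show i + 1 ≤ k by omega) hk2.le, h1,
    one_mul, starProd_of_lt w hk2, h2, mul_one, hwk, Equiv.swap_mul_self]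

/-- If the product is trivial, then the point which is at `0` at time `k` and ends at `b` jumps over
complete pairs, one after the other, until the second occurrence of `b` at time `j` (or until the
end `j = m` of the word if `b = 0`); in particular the interval `[k, j)` is a union of pairs. -/
theorem closed_of_starProd_eq_one (hw : IsPairedWord w m s) (h1 : starProd w 0 m = 1)
    (b k j : ℕ) (hjm : j ≤ m) (hkj : k ≤ j) (hkb : ∀ l, k ≤ l → l < j → w l ≠ b)
    (hb : ∀ l, j < l → l < m → w l ≠ b)
    (hf : (starProd w k m)⁻¹ 0 = b) (hb0 : b = 0 → j = m) :
    ∀ l, k ≤ l → l < j → k ≤ s l ∧ s l < j := by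
  induction hd : j - k using Nat.strong_induction_on generalizing b k j with
  | _ d ih =>
  rcases hkj.eq_or_lt with rfl | hkj
  · intro l h1 h2
    omega
  have hkm : k < m := by omega
  have hc0 := hw.ne_zero k hkm
  have hcb := hkb k le_rfl hkj
  have hs := hw.lt k hkm
  have hne := hw.ne k hkm
  have hss := hw.invol k hkm
  have hmap := hw.map k hkm
  have hor := hw.eq_or k hkm
  set k' := s k with hk'
  rw [starProd_inv_apply_of_lt w hkm, Equiv.swap_apply_left] at hf
  -- `k` is the first occurrence of its letter, as otherwise this letter would not move any more
  have hkk : k < k' := by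
    by_contra hlt
    apply hcb
    rw [← hf, eq_comm, Equiv.Perm.inv_eq_iff_eq, starProd_apply_of_ne w hc0]
    intro l hl1 hl2 hl
    rcases hor l hl2 hl with h | h <;> omega
  rw [starProd_inv_apply_of_ne w (show k + 1 ≤ k' by omega) hs.le hc0, ← hmap,
    starProd_inv_apply_of_lt w hs, Equiv.swap_apply_right] at hf
  swap
  · intro l hl1 hl2 hl
    rcases hor l (by omega) hl with h | h <;> omega
  have hk'j : k' < j := by
    by_contra hlt
    have hb0' : b ≠ 0 := fun h => by have := hb0 h; omega
    have hjk' : j ≤ k' := by omega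
    have hfix : starProd w (k' + 1) m b = b :=
      starProd_apply_of_ne w hb0' fun l hl1 hl2 => hb l (by omega) hl2
    rw [Equiv.Perm.inv_eq_iff_eq, hfix] at hf
    exact hb0' hf.symm
  have hin := ih (k' - (k + 1)) (by omega) (w k) (k + 1) k' hs.le (by omega)
    (fun l hl1 hl2 hl => by rcases hor l (by omega) hl with h | h <;> omega)
    (fun l hl1 hl2 hl => by rcases hor l (by omega) hl with h | h <;> omega)
    (by
      have h0 : (starProd w 0 m)⁻¹ (w k) = w k := by simp [h1]
      rwa [starProd_inv_apply_of_ne w (Nat.zero_le k) hkm.le hc0, starProd_inv_apply_of_lt w hkm,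
        Equiv.swap_apply_right] at h0
      intro l hl1 hl2 hl
      rcases hor l (by omega) hl with h | h <;> omega)
    (fun h => absurd h hc0) rfl
  have hout := ih (j - (k' + 1)) (by omega) b (k' + 1) j hjm (by omega)
    (fun l hl1 hl2 => hkb l (by omega) hl2) hb hf hb0 rfl
  intro l hl1 hl2
  rcases lt_trichotomy l k' with hl | rfl | hl
  · rcases hl1.eq_or_lt with rfl | hl1
    · omega
    · have := hin l hl1 hl
      omega
  · omega
  · have := hout l hl hl2
    omega

theorem noncrossing_of_starProd_eq_one (hw : IsPairedWord w m s) (h1 : starProd w 0 m = 1)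
    (a b c d : ℕ) (hab : a < b) (hbc : b < c) (hcd : c < d) (hdm : d < m)
    (hac : w a = w c) (hbd : w b = w d) : w a = w b := by
  have ham : a < m := by omega
  have hor := hw.eq_or a ham
  have hc : c = s a := by rcases hor c (by omega) hac.symm with h | h <;> omega
  have hd : d = s b := by
    rcases hw.eq_or b (by omega) d (by omega) hbd.symm with h | h <;> omega
  have := hw.closed_of_starProd_eq_one h1 (w a) (a + 1) c (by omega) (by omega)
    (fun l hl1 hl2 hl => by rcases hor l (by omega) hl with h | h <;> omega)
    (fun l hl1 hl2 hl => by rcases hor l (by omega) hl with h | h <;> omega)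
    (by
      have h0 : (starProd w 0 m)⁻¹ (w a) = w a := by simp [h1]
      rwa [starProd_inv_apply_of_ne w (Nat.zero_le a) ham.le (hw.ne_zero a ham),
        starProd_inv_apply_of_lt w ham, Equiv.swap_apply_right] at h0
      intro l hl1 hl2 hl
      rcases hor l (by omega) hl with h | h <;> omega)
    (fun h => absurd h (hw.ne_zero a ham)) b hab hbc
  omega

end IsPairedWord

theorem prod_swap_eq_starProd {m : ℕ} (a : Fin m → ℕ) :
    (List.ofFn fun k => Equiv.swap 0 (a k)).prod =
      starProd (fun k => if h : k < m then a ⟨k, h⟩ else 0) 0 m := by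
  unfold starProd
  congr 1
  refine List.ext_getElem (by simp) fun i h1 h2 => ?_
  have him : i < m := by simpa using h1
  simp [List.Ico, him]

/-- For a word in which each letter occurs exactly twice, the product of star transpositions is
trivial if and only if the pairing of equal letters is noncrossing. -/
theorem prod_swap_eq_one_iff {m : ℕ} (a : Fin m → ℕ) (h0 : ∀ k, a k ≠ 0)
    (hp : (Setoid.ker a).IsPairing) :
    (List.ofFn fun k => Equiv.swap 0 (a k)).prod = 1 ↔ (Setoid.ker a).IsNoncrossing := by
  have hex : ∀ k : Fin m, ∃ l, l ≠ k ∧ a l = a k ∧ ∀ i, a i = a k → i = k ∨ i = l := by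
    intro k
    obtain ⟨x, y, hxy, hset⟩ := Set.ncard_eq_two.1 (hp k)
    have hmem : ∀ i, a i = a k ↔ i = x ∨ i = y := fun i => by
      have := Set.ext_iff.1 hset i
      simp only [Set.mem_ofPred_eq, Setoid.ker_def, Set.mem_insert_iff, Set.mem_singleton_iff]
        at this
      rw [← this, eq_comm]
    rcases (hmem k).1 rfl with rfl | rfl
    · exact ⟨y, hxy.symm, (hmem y).2 (Or.inr rfl), fun i hi => (hmem i).1 hi⟩
    · exact ⟨x, hxy, (hmem x).2 (Or.inl rfl), fun i hi => ((hmem i).1 hi).symm⟩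
  choose t ht1 ht2 ht3 using hex
  rw [prod_swap_eq_starProd]
  set w : ℕ → ℕ := fun k => if h : k < m then a ⟨k, h⟩ else 0 with hw
  have hwa : ∀ k (h : k < m), w k = a ⟨k, h⟩ := fun k h => by simp [hw, h]
  let s : ℕ → ℕ := fun k => if h : k < m then t ⟨k, h⟩ else 0
  have hs : ∀ k (h : k < m), s k = t ⟨k, h⟩ := fun k h => by simp [s, h]
  have hpw : IsPairedWord w m s :=
    { ne_zero := fun k hk => by rw [hwa k hk]; exact h0 _
      lt := fun k hk => by rw [hs k hk]; exact (t _).2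
      ne := fun k hk => by
        rw [hs k hk]
        exact fun h => ht1 ⟨k, hk⟩ (Fin.ext h)
      map := fun k hk => by
        rw [hwa k hk, hs k hk, hwa _ (t ⟨k, hk⟩).2]
        exact ht2 _
      invol := fun k hk => by
        rw [hs k hk, hs _ (t ⟨k, hk⟩).2]
        rcases ht3 (t ⟨k, hk⟩) ⟨k, hk⟩ (ht2 _).symm with h | h
        · exact absurd h.symm (ht1 _)
        · exact congrArg Fin.val h.symm
      eq_or := fun k hk l hl h => by
        rw [hwa k hk, hwa l hl] at h
        rw [hs k hk]
        exact (ht3 _ _ h).imp (congrArg Fin.val) (congrArg Fin.val) }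
  constructor
  · intro h1 x y z u hxy hyz hzu hxz hyu
    have := hpw.noncrossing_of_starProd_eq_one h1 x y z u hxy hyz hzu u.2
      (by simpa [hwa _ (Fin.is_lt _)] using hxz) (by simpa [hwa _ (Fin.is_lt _)] using hyu)
    simpa [hwa _ (Fin.is_lt _)] using this
  · intro hnc
    refine hpw.starProd_eq_one (fun x y z u hxy hyz hzu hum hxz hyu => ?_) 0 m le_rfl
      fun k _ hk => ⟨Nat.zero_le _, hpw.lt k hk⟩
    rw [hwa x (by omega), hwa z (by omega)] at hxz
    rw [hwa y (by omega), hwa u (by omega)] at hyu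
    rw [hwa x (by omega), hwa y (by omega)]
    exact hnc ⟨x, by omega⟩ ⟨y, by omega⟩ ⟨z, by omega⟩ ⟨u, by omega⟩ hxy hyz hzu hxz hyu

/-- A letter which occurs only once is moved by the product of star transpositions. -/
theorem prod_swap_ne_one {m : ℕ} (a : Fin m → ℕ) (h0 : ∀ k, a k ≠ 0) (k : Fin m)
    (hk : ∀ l, a l = a k → l = k) : (List.ofFn fun k => Equiv.swap 0 (a k)).prod ≠ 1 := by
  rw [prod_swap_eq_starProd]
  set w : ℕ → ℕ := fun k => if h : k < m then a ⟨k, h⟩ else 0 with hw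
  have hwa : ∀ k (h : k < m), w k = a ⟨k, h⟩ := fun k h => by simp [hw, h]
  have hne : ∀ l : ℕ, l ≠ k → l < m → w l ≠ a k := fun l hl hlm h => by
    rw [hwa l hlm] at h
    exact hl (congrArg Fin.val (hk _ h))
  intro h1
  rw [← starProd_mul_starProd w (Nat.zero_le k) k.2.le, starProd_of_lt w k.2] at h1
  have h2 := DFunLike.congr_fun h1 (a k)
  rw [Equiv.Perm.mul_apply, Equiv.Perm.mul_apply,
    starProd_apply_of_ne w (h0 k) (fun l hl hlm => hne l (by omega) hlm), hwa k k.2,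
    Equiv.swap_apply_right, Equiv.Perm.one_apply] at h2
  have h3 := starProd_apply_of_ne w (i := 0) (j := k) (h0 k)
    fun l _ hl => hne l (by omega) (by omega)
  exact h0 k ((starProd w 0 k).injective (h3.trans h2.symm))

/-! ### The model in terms of star transpositions -/

/-- The transposition `(0 x)`. -/
def starTransposition (x : ℕ) : FinitaryPerm :=
  ⟨Equiv.swap 0 x, (Set.toFinite {0, x}).subset fun y hy => by
    by_contra h
    simp only [Set.mem_insert_iff, Set.mem_singleton_iff, not_or] at h
    exact hy (Equiv.swap_apply_of_ne_of_ne h.1 h.2)⟩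

theorem prod_starTransposition_eq_one_iff {m : ℕ} (a : Fin m → ℕ) :
    (List.ofFn fun k => starTransposition (a k)).prod = 1 ↔
      (List.ofFn fun k => Equiv.swap 0 (a k)).prod = 1 := by
  rw [Subtype.ext_iff, Subgroup.coe_one, ← Subgroup.subtype_apply, map_list_prod, List.map_ofFn]
  rfl

/-- The factorization of a cycle through `x` into star transpositions centred at `x`. -/
theorem List.formPerm_cons_eq_prod_swap {α : Type*} [DecidableEq α] (x : α) (l : List α)
    (h : (x :: l).Nodup) : (x :: l).formPerm = ((l.map (Equiv.swap x)).reverse).prod := by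
  induction l generalizing x with
  | nil => simp
  | cons y l ih =>
    rw [List.formPerm_cons_cons, ih y h.of_cons, List.map_cons, List.reverse_cons,
      List.prod_append, List.prod_singleton]
    have key : ∀ z ∈ l, MulAut.conj (Equiv.swap x y) (Equiv.swap y z) = Equiv.swap x z := by
      intro z hz
      have hxz : z ≠ x := by rintro rfl; simp [hz] at h
      have hyz : z ≠ y := by rintro rfl; simp [hz] at h
      rw [MulAut.conj_apply, ← Equiv.swap_apply_apply, Equiv.swap_apply_right,
        Equiv.swap_apply_of_ne_of_ne hxz hyz]
    rw [← List.map_congr_left key, ← Function.comp_def (MulAut.conj (Equiv.swap x y)),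
      ← List.map_map, ← List.map_reverse (f := MulAut.conj _), ← map_list_prod, MulAut.conj_apply]
    simp [mul_assoc]

theorem zeroCycle_eq_prod {r : ℕ} (a : Fin r → ℕ) (ha : Function.Injective a)
    (h0 : ∀ i, a i ≠ 0) :
    zeroCycle a = (List.ofFn fun i => starTransposition (a (Fin.rev i))).prod := by
  have hr : List.ofFn (fun i => starTransposition (a (Fin.rev i))) =
      ((List.ofFn a).map starTransposition).reverse := by
    refine List.ext_getElem (by simp) fun i h1 h2 => ?_
    simp [Fin.rev, Nat.sub_sub, Nat.add_comm]
  rw [hr, Subtype.ext_iff, ← Subgroup.subtype_apply, ← Subgroup.subtype_apply, map_list_prod,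
    List.map_reverse, List.map_map]
  refine List.formPerm_cons_eq_prod_swap 0 (List.ofFn a) (List.nodup_cons.2 ⟨?_, ?_⟩)
  · simpa [List.mem_ofFn] using h0
  · exact List.nodup_ofFn.2 ha

/-- Reversing the tuples turns `M_r(n)` into a sum of products of star transpositions. -/
theorem permModel_eq (r n : ℕ) :
    permModel r n 1 = (((n : ℝ) ^ (-(r : ℝ) / 2) : ℝ) : ℂ) •
      ∑ a : Fin r ↪ Finset.Icc 1 n, MonoidAlgebra.of ℂ FinitaryPerm
        (List.ofFn fun i => starTransposition (a i : ℕ)).prod := by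
  have hn : ⌊(n : ℝ) * 1⌋₊ = n := by simp
  rw [permModel, hn]
  congr 1
  refine Fintype.sum_equiv (Equiv.embeddingCongr Fin.revPerm (Equiv.refl _)) _ _ fun a => ?_
  rw [zeroCycle_eq_prod]
  · rfl
  · exact Subtype.val_injective.comp a.injective
  · intro i
    have := (Finset.mem_Icc.1 (a i).2).1
    omega

/-! ### The successive intervals of a composition -/

theorem finSigmaFinEquiv_lt {p : ℕ} {r : Fin p → ℕ} {i j : Fin p} (hij : i < j)
    (x : Fin (r i)) (y : Fin (r j)) :
    finSigmaFinEquiv ⟨i, x⟩ < finSigmaFinEquiv ⟨j, y⟩ := by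
  have key : ∀ k : Fin p, (∑ l : Fin k, r (Fin.castLE k.2.le l)) = ∑ l ∈ Finset.Iio k, r l := by
    intro k
    refine Finset.sum_bij (fun l _ => Fin.castLE k.2.le l) ?_ ?_ ?_ ?_
    · intro l _
      exact Finset.mem_Iio.2 l.2
    · intro a _ b _ h
      exact Fin.castLE_injective _ h
    · intro b hb
      exact ⟨⟨b, Fin.lt_def.1 (Finset.mem_Iio.1 hb)⟩, Finset.mem_univ _, rfl⟩
    · simp
  rw [Fin.lt_def, finSigmaFinEquiv_apply, finSigmaFinEquiv_apply, key, key]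
  have h1 : ∑ l ∈ Finset.Iio i, r l + r i ≤ ∑ l ∈ Finset.Iio j, r l := by
    rw [add_comm, ← Finset.sum_insert (by simp : i ∉ Finset.Iio i)]
    refine Finset.sum_le_sum_of_subset fun k hk => ?_
    rcases Finset.mem_insert.1 hk with rfl | hk
    · exact Finset.mem_Iio.2 hij
    · exact Finset.mem_Iio.2 ((Finset.mem_Iio.1 hk).trans hij)
  have := x.2
  dsimp only
  omega

theorem finSigmaFinEquiv_lt_of_lt {p : ℕ} {r : Fin p → ℕ} (i : Fin p) {x y : Fin (r i)}
    (h : x < y) : finSigmaFinEquiv (⟨i, x⟩ : (i : Fin p) × Fin (r i)) <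
      finSigmaFinEquiv ⟨i, y⟩ := by
  rw [Fin.lt_def, finSigmaFinEquiv_apply, finSigmaFinEquiv_apply]
  have : (x : ℕ) < y := h
  dsimp only
  omega

theorem blockIndex_monotone {p : ℕ} (r : Fin p → ℕ+) : Monotone (blockIndex r) := by
  intro x y hxy
  by_contra h
  have := finSigmaFinEquiv_lt (r := fun i => (r i : ℕ)) (not_le.1 h)
    (finSigmaFinEquiv.symm y).2 (finSigmaFinEquiv.symm x).2
  simp only [blockIndex, Sigma.eta, Equiv.apply_symm_apply] at this
  exact absurd hxy (not_le.2 this)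

theorem blockIndex_finSigmaFinEquiv {p : ℕ} (r : Fin p → ℕ+) (i : Fin p) (x : Fin (r i)) :
    blockIndex r (finSigmaFinEquiv ⟨i, x⟩) = i :=
  congrArg Sigma.fst (finSigmaFinEquiv.symm_apply_apply (⟨i, x⟩ : (i : Fin p) × Fin (r i)))

theorem apply_symm_finSigmaFinEquiv {p : ℕ} {r : Fin p → ℕ} {X : Type*} (a : ∀ i, Fin (r i) → X)
    (i : Fin p) (x : Fin (r i)) :
    a (finSigmaFinEquiv.symm (finSigmaFinEquiv (⟨i, x⟩ : (i : Fin p) × Fin (r i)))).1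
      (finSigmaFinEquiv.symm (finSigmaFinEquiv ⟨i, x⟩)).2 = a i x :=
  congrArg (fun s : (i : Fin p) × Fin (r i) => a s.1 s.2)
    (finSigmaFinEquiv.symm_apply_apply (⟨i, x⟩ : (i : Fin p) × Fin (r i)))

theorem blockIndex_surjective {p : ℕ} (r : Fin p → ℕ+) : Function.Surjective (blockIndex r) :=
  fun i => ⟨finSigmaFinEquiv ⟨i, ⟨0, (r i).pos⟩⟩, blockIndex_finSigmaFinEquiv r i _⟩

/-- Concatenating words of lengths `r 0, r 1, …` gives a word of length `|r|`. -/
theorem flatten_ofFn_finSigmaFinEquiv {p : ℕ} (r : Fin p → ℕ) {X : Type*}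
    (A : Fin (∑ i, r i) → X) :
    (List.ofFn fun i => List.ofFn fun j : Fin (r i) => A (finSigmaFinEquiv ⟨i, j⟩)).flatten =
      List.ofFn A := by
  set L := (List.ofFn fun i => List.ofFn fun j : Fin (r i) =>
    finSigmaFinEquiv (⟨i, j⟩ : (i : Fin p) × Fin (r i))).flatten with hL
  have hsorted : L.Pairwise (· < ·) := by
    rw [hL, List.pairwise_flatten]
    constructor
    · intro l hl
      obtain ⟨i, rfl⟩ := (List.mem_ofFn' _ _).1 hl
      exact List.pairwise_ofFn.2 fun x y hxy => finSigmaFinEquiv_lt_of_lt i hxy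
    · refine List.pairwise_ofFn.2 fun i j hij x hx y hy => ?_
      obtain ⟨x, rfl⟩ := (List.mem_ofFn' _ _).1 hx
      obtain ⟨y, rfl⟩ := (List.mem_ofFn' _ _).1 hy
      exact finSigmaFinEquiv_lt hij x y
  have hmem : ∀ x, x ∈ L := by
    intro x
    rw [hL, List.mem_flatten]
    refine ⟨_, (List.mem_ofFn' _ _).2 ⟨(finSigmaFinEquiv.symm x).1, rfl⟩,
      (List.mem_ofFn' _ _).2 ⟨(finSigmaFinEquiv.symm x).2, ?_⟩⟩
    simp
  have hfin : L = List.finRange _ := by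
    refine List.Perm.eq_of_pairwise' hsorted (List.pairwise_lt_finRange _) ?_
    refine (List.perm_ext_iff_of_nodup (hsorted.imp fun h => h.ne) (List.nodup_finRange _)).2 ?_
    simp [hmem]
  rw [List.ofFn_eq_map (f := A), ← hfin, hL, List.map_flatten, List.map_ofFn]
  congr 2
  funext i
  simp [List.map_ofFn, Function.comp_def]

/-! ### The trace of a product as a count -/

/-- The words `A` of length `|r|` over `[1, n]`, without repetition in any of the successive
intervals of lengths `r 0, r 1, …`, for which the product of the transpositions `(0 A_k)` is
trivial. -/
def trivialWords {p : ℕ} (r : Fin p → ℕ+) (n : ℕ) :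
    Set (Fin (∑ i, (r i : ℕ)) → Finset.Icc 1 n) :=
  {A | Setoid.ker A ⊓ blockPartition r = ⊥ ∧
    (List.ofFn fun k => Equiv.swap 0 (A k : ℕ)).prod = 1}

theorem ker_inf_blockPartition_eq_bot_iff {p : ℕ} (r : Fin p → ℕ+) {X : Type*}
    (A : Fin (∑ i, (r i : ℕ)) → X) :
    Setoid.ker A ⊓ blockPartition r = ⊥ ↔
      ∀ i, Function.Injective fun j : Fin (r i) => A (finSigmaFinEquiv ⟨i, j⟩) := by
  constructor
  · intro h i x y hxy
    have : (Setoid.ker A ⊓ blockPartition r)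
        (finSigmaFinEquiv ⟨i, x⟩) (finSigmaFinEquiv ⟨i, y⟩) :=
      ⟨hxy, (blockIndex_finSigmaFinEquiv r i x).trans (blockIndex_finSigmaFinEquiv r i y).symm⟩
    rw [h] at this
    have := finSigmaFinEquiv.injective (this : finSigmaFinEquiv _ = finSigmaFinEquiv _)
    simpa using this
  · intro h
    refine le_bot_iff.1 fun x y hxy => ?_
    obtain ⟨h1, h2⟩ := hxy
    obtain ⟨⟨i, x⟩, rfl⟩ := finSigmaFinEquiv.surjective x
    obtain ⟨⟨j, y⟩, rfl⟩ := finSigmaFinEquiv.surjective y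
    obtain rfl : i = j := by
      rw [← blockIndex_finSigmaFinEquiv r i x, ← blockIndex_finSigmaFinEquiv r j y]
      exact h2
    obtain rfl := h i h1
    rfl

theorem groupTrace_sum_of {G ι : Type*} [Group G] [Fintype ι] (g : ι → G) :
    groupTrace G (∑ i, MonoidAlgebra.of ℂ G (g i)) = (Nat.card {i // g i = 1} : ℂ) := by
  classical
  rw [map_sum, Nat.card_eq_fintype_card, Fintype.card_subtype, Finset.card_filter, Nat.cast_sum]
  refine Finset.sum_congr rfl fun i _ => ?_
  change (MonoidAlgebra.single (g i) (1 : ℂ)).coeff 1 = _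
  simp [Finsupp.single_apply]

theorem groupTrace_prod_permModel {p : ℕ} (r : Fin p → ℕ+) (n : ℕ) :
    groupTrace FinitaryPerm (List.ofFn fun i => permModel (r i) n 1).prod =
      (((∏ i, (n : ℝ) ^ (-(r i : ℝ) / 2)) * (trivialWords r n).ncard : ℝ) : ℂ) := by
  simp_rw [permModel_eq]
  rw [← MultilinearMap.mkPiAlgebraFin_apply (R := ℂ), MultilinearMap.map_smul_univ,
    MultilinearMap.map_sum]
  simp_rw [MultilinearMap.mkPiAlgebraFin_apply]
  have h1 : ∀ a : (i : Fin p) → (Fin (r i) ↪ Finset.Icc 1 n),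
      (List.ofFn fun i => MonoidAlgebra.of ℂ FinitaryPerm
        (List.ofFn fun j => starTransposition (a i j : ℕ)).prod).prod =
      MonoidAlgebra.of ℂ FinitaryPerm
        (List.ofFn fun i => (List.ofFn fun j => starTransposition (a i j : ℕ)).prod).prod := by
    intro a
    rw [map_list_prod, List.map_ofFn]
    rfl
  simp_rw [h1]
  rw [map_smul, groupTrace_sum_of, smul_eq_mul]
  push_cast
  congr 2
  rw [← Nat.card_coe_set_eq]
  refine Nat.card_congr
    { toFun := fun a => ⟨fun k => a.1 (finSigmaFinEquiv.symm k).1 (finSigmaFinEquiv.symm k).2, ?_⟩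
      invFun := fun A => ⟨fun i => ⟨fun j => A.1 (finSigmaFinEquiv ⟨i, j⟩),
        (ker_inf_blockPartition_eq_bot_iff r A.1).1 A.2.1 i⟩, ?_⟩
      left_inv := ?_
      right_inv := ?_ }
  · obtain ⟨a, ha⟩ := a
    refine ⟨(ker_inf_blockPartition_eq_bot_iff r _).2 fun i => ?_, ?_⟩
    · simp_rw [apply_symm_finSigmaFinEquiv (fun i j => a i j)]
      exact (a i).injective
    · rw [← prod_starTransposition_eq_one_iff, ← flatten_ofFn_finSigmaFinEquiv, List.prod_flatten,
        List.map_ofFn, Function.comp_def]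
      simp_rw [apply_symm_finSigmaFinEquiv (fun i j => (a i j))]
      exact ha
  · have := A.2.2
    rw [← prod_starTransposition_eq_one_iff, ← flatten_ofFn_finSigmaFinEquiv, List.prod_flatten,
        List.map_ofFn] at this
    exact this
  · intro a
    ext i j
    exact congrArg Subtype.val (apply_symm_finSigmaFinEquiv (fun i j => a.1 i j) i j)
  · intro A
    ext k
    simp

/-! ### Counting words by their kernel -/

/-- The words with kernel `π` are the injections of the set of classes of `π`. -/
theorem ncard_ker_eq {α X : Type*} [Finite α] [Finite X] (π : Setoid α) :
    {A : α → X | Setoid.ker A = π}.ncard = (Nat.card X).descFactorial (Nat.card (Quotient π)) := by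
  classical
  have := Fintype.ofFinite (Quotient π)
  have := Fintype.ofFinite X
  rw [Nat.card_eq_fintype_card, Nat.card_eq_fintype_card, ← Fintype.card_embedding_eq,
    ← Nat.card_eq_fintype_card, ← Nat.card_coe_set_eq]
  refine Nat.card_congr
    { toFun := fun A => ⟨Quotient.lift A.1 fun a b (h : π a b) => ?_, ?_⟩
      invFun := fun e => ⟨fun a => e (Quotient.mk π a), ?_⟩
      left_inv := fun A => rfl
      right_inv := fun e => ?_ }
  · rw [← A.2] at h
    exact h
  · rintro ⟨a⟩ ⟨b⟩ h
    refine Quotient.sound (s := π) ?_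
    have : Setoid.ker A.1 a b := h
    rw [A.2] at this
    exact this
  · refine Setoid.ext fun a b => ?_
    rw [Setoid.ker_def, e.injective.eq_iff]
    exact Quotient.eq
  · ext q
    induction q using Quotient.inductionOn
    rfl

theorem sum_ncard_classes {α : Type*} [Finite α] (π : Setoid α) :
    haveI := Fintype.ofFinite (Quotient π)
    ∑ q : Quotient π, {a | Quotient.mk π a = q}.ncard = Nat.card α := by
  classical
  have := Fintype.ofFinite (Quotient π)
  rw [← Nat.card_congr (Equiv.sigmaFiberEquiv (Quotient.mk π)), Nat.card_sigma]
  exact Finset.sum_congr (by congr!) fun q _ => (Nat.card_coe_set_eq _).symm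

theorem setOf_mk_eq {α : Type*} (π : Setoid α) (a : α) :
    {b | Quotient.mk π b = Quotient.mk π a} = {b | π a b} := by
  ext b
  exact Quotient.eq.trans ⟨π.symm, π.symm⟩

theorem Setoid.IsPairing.card_quotient {α : Type*} [Finite α] {π : Setoid α} (h : π.IsPairing) :
    2 * Nat.card (Quotient π) = Nat.card α := by
  have := Fintype.ofFinite (Quotient π)
  rw [← sum_ncard_classes π, Nat.card_eq_fintype_card, mul_comm, ← smul_eq_mul,
    ← Finset.card_univ, ← Finset.sum_const]
  refine Finset.sum_congr (by congr!) fun q _ => ?_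
  induction q using Quotient.inductionOn with
  | _ a => rw [setOf_mk_eq, h a]

theorem card_quotient_lt_of_not_isPairing {α : Type*} [Finite α] {π : Setoid α}
    (h : ¬π.IsPairing) (h2 : ∀ a, 2 ≤ {b | π a b}.ncard) :
    2 * Nat.card (Quotient π) < Nat.card α := by
  have := Fintype.ofFinite (Quotient π)
  obtain ⟨a, ha⟩ := not_forall.1 h
  rw [← sum_ncard_classes π, Nat.card_eq_fintype_card, mul_comm, ← smul_eq_mul,
    ← Finset.card_univ, ← Finset.sum_const]
  refine lt_of_lt_of_le (Finset.sum_lt_sum (fun q _ => ?_) ⟨Quotient.mk π a, Finset.mem_univ _, ?_⟩)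
    (le_of_eq (Finset.sum_congr (by congr!) fun q _ => rfl))
  · induction q using Quotient.inductionOn with
    | _ b => rw [setOf_mk_eq]; exact h2 b
  · rw [setOf_mk_eq]
    exact lt_of_le_of_ne (h2 a) (Ne.symm ha)

/-! ### The limit of the moments -/

/-- Words in `trivialWords r n` with kernel `π`, after normalization, count `1` in the limit if
`π ∈ NC2 r` and `0` otherwise. -/
theorem tendsto_ncard_trivialWords_ker {p : ℕ} (r : Fin p → ℕ+)
    (π : Setoid (Fin (∑ i, (r i : ℕ)))) [Decidable (π ∈ NC2 r)] :
    Tendsto (fun n : ℕ => (n : ℝ) ^ (-((∑ i, (r i : ℕ) : ℕ) : ℝ) / 2) *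
      ({A ∈ trivialWords r n | Setoid.ker A = π}.ncard : ℝ)) atTop
      (𝓝 (if π ∈ NC2 r then 1 else 0)) := by
  have hcard : ∀ n : ℕ, {A : Fin (∑ i, (r i : ℕ)) → Finset.Icc 1 n | Setoid.ker A = π}.ncard =
      n.descFactorial (Nat.card (Quotient π)) := fun n => by
    rw [ncard_ker_eq, Nat.card_eq_fintype_card, Fintype.card_coe, Nat.card_Icc, Nat.add_sub_cancel]
  have hne : ∀ (n : ℕ) (A : Fin (∑ i, (r i : ℕ)) → Finset.Icc 1 n) (k : Fin (∑ i, (r i : ℕ))),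
      (A k : ℕ) ≠ 0 := fun n A k => by
    have := (Finset.mem_Icc.1 (A k).2).1
    omega
  have hker : ∀ (n : ℕ) (A : Fin (∑ i, (r i : ℕ)) → Finset.Icc 1 n),
      Setoid.ker (fun k => (A k : ℕ)) = Setoid.ker A := fun n A =>
    Setoid.ext fun a b => Subtype.val_injective.eq_iff
  have hzero : (∀ (n : ℕ) (A : Fin (∑ i, (r i : ℕ)) → Finset.Icc 1 n), Setoid.ker A = π →
      A ∉ trivialWords r n) →
      Tendsto (fun n : ℕ => (n : ℝ) ^ (-((∑ i, (r i : ℕ) : ℕ) : ℝ) / 2) *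
        ({A ∈ trivialWords r n | Setoid.ker A = π}.ncard : ℝ)) atTop (𝓝 0) := by
    intro h
    refine tendsto_const_nhds.congr fun n => ?_
    have : {A ∈ trivialWords r n | Setoid.ker A = π} = ∅ :=
      Set.eq_empty_of_forall_notMem fun A hA => h n A hA.2 hA.1
    rw [this]
    simp
  split_ifs with hπ
  · obtain ⟨hnc, hpair, hinf⟩ := hπ
    have h2 := hpair.card_quotient
    rw [Nat.card_eq_fintype_card (α := Fin (∑ i, (r i : ℕ))), Fintype.card_fin] at h2
    set k := Nat.card (Quotient π)
    have hset : ∀ n, {A ∈ trivialWords r n | Setoid.ker A = π} = {A | Setoid.ker A = π} := by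
      intro n
      ext A
      refine ⟨fun h => h.2, fun h => ⟨⟨?_, ?_⟩, h⟩⟩
      · rw [show Setoid.ker A = π from h]
        exact hinf
      · have hk : Setoid.ker (fun k => (A k : ℕ)) = π := (hker n A).trans h
        rw [prod_swap_eq_one_iff _ (hne n A) (hk ▸ hpair), hk]
        exact hnc
    have hlim := isEquivalent_descFactorial k
    rw [Asymptotics.isEquivalent_iff_tendsto_one] at hlim
    swap
    · filter_upwards [eventually_gt_atTop 0] with n hn
      positivity
    refine hlim.congr' ?_
    filter_upwards [eventually_gt_atTop 0] with n hn
    have hn' : (0 : ℝ) ≤ n := Nat.cast_nonneg n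
    rw [hset, hcard, Pi.div_apply, ← h2]
    have : -((2 * k : ℕ) : ℝ) / 2 = -(k : ℝ) := by push_cast; ring
    rw [this, Real.rpow_neg hn', Real.rpow_natCast, div_eq_inv_mul]
  · by_cases hinf : π ⊓ blockPartition r = ⊥
    swap
    · exact hzero fun n A hA h => hinf (hA ▸ h.1)
    by_cases hpair : π.IsPairing
    · refine hzero fun n A hA h => hπ ⟨?_, hpair, hinf⟩
      have hk : Setoid.ker (fun k => (A k : ℕ)) = π := (hker n A).trans hA
      rw [← hk]
      exact (prod_swap_eq_one_iff _ (hne n A) (hk ▸ hpair)).1 h.2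
    by_cases hsing : ∀ a, 2 ≤ {b | π a b}.ncard
    · have h2 := card_quotient_lt_of_not_isPairing hpair hsing
      rw [Nat.card_eq_fintype_card (α := Fin (∑ i, (r i : ℕ))), Fintype.card_fin] at h2
      set k := Nat.card (Quotient π)
      have hpos : (0 : ℝ) < ((∑ i, (r i : ℕ) : ℕ) : ℝ) / 2 - k := by
        have : ((2 * k : ℕ) : ℝ) < ((∑ i, (r i : ℕ) : ℕ) : ℝ) := by exact_mod_cast h2
        rw [Nat.cast_mul, Nat.cast_ofNat] at this
        linarith
      refine squeeze_zero' (Eventually.of_forall fun n => by positivity) ?_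
        ((tendsto_rpow_neg_atTop hpos).comp tendsto_natCast_atTop_atTop)
      filter_upwards [eventually_gt_atTop 0] with n hn
      have hn' : (0 : ℝ) < n := Nat.cast_pos.2 hn
      have hle : ({A ∈ trivialWords r n | Setoid.ker A = π}.ncard : ℝ) ≤ (n : ℝ) ^ (k : ℝ) := by
        rw [Real.rpow_natCast]
        have hsub : {A ∈ trivialWords r n | Setoid.ker A = π} ⊆ {A | Setoid.ker A = π} :=
          fun A hA => hA.2
        exact_mod_cast (Set.ncard_le_ncard hsub (Set.toFinite _)).trans
          ((hcard n).le.trans (Nat.descFactorial_le_pow n k))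
      calc (n : ℝ) ^ (-((∑ i, (r i : ℕ) : ℕ) : ℝ) / 2) *
            ({A ∈ trivialWords r n | Setoid.ker A = π}.ncard : ℝ)
          ≤ (n : ℝ) ^ (-((∑ i, (r i : ℕ) : ℕ) : ℝ) / 2) * (n : ℝ) ^ (k : ℝ) := by gcongr
        _ = (n : ℝ) ^ (-(((∑ i, (r i : ℕ) : ℕ) : ℝ) / 2 - k)) := by
            rw [← Real.rpow_add hn']
            ring_nf
    · obtain ⟨a, ha⟩ := not_forall.1 hsing
      refine hzero fun n A hA h => prod_swap_ne_one _ (hne n A) a (fun l hl => ?_) h.2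
      have hl' : π a l := by
        rw [← hA]
        exact Subtype.ext hl.symm
      have hle : {b | π a b}.ncard ≤ 1 := by omega
      exact (Set.ncard_le_one (Set.toFinite _)).1 hle l hl' a (π.refl a)

/-- The mixed moments of the permutation model converge to the numbers of noncrossing pairings. -/
theorem tendsto_groupTrace_prod_permModel {p : ℕ} (r : Fin p → ℕ+) :
    Tendsto (fun n : ℕ => groupTrace FinitaryPerm (List.ofFn fun i => permModel (r i) n 1).prod)
      atTop (𝓝 ((NC2 r).ncard : ℂ)) := by
  classical
  simp_rw [groupTrace_prod_permModel]
  have hlim := tendsto_finsetSum (Finset.univ : Finset (Setoid (Fin (∑ i, (r i : ℕ)))))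
    fun π _ => tendsto_ncard_trivialWords_ker r π
  have hcard : (∑ π : Setoid (Fin (∑ i, (r i : ℕ))), if π ∈ NC2 r then (1 : ℝ) else 0) =
      ((NC2 r).ncard : ℝ) := by
    rw [Finset.sum_boole, Set.ncard_eq_toFinset_card', Set.filter_mem_univ_eq_toFinset]
  rw [hcard] at hlim
  refine ((Complex.continuous_ofReal.tendsto _).comp hlim).congr' ?_
  filter_upwards [eventually_gt_atTop 0] with n hn
  have hsum : (trivialWords r n).ncard = ∑ π : Setoid (Fin (∑ i, (r i : ℕ))),
      {A ∈ trivialWords r n | Setoid.ker A = π}.ncard := by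
    rw [Set.ncard_eq_toFinset_card', Finset.card_eq_sum_card_fiberwise
      (f := fun A => Setoid.ker A) (t := Finset.univ) fun _ _ => Finset.mem_coe.2 (Finset.mem_univ _)]
    refine Finset.sum_congr rfl fun π _ => ?_
    rw [Set.ncard_eq_toFinset_card']
    congr 1
    ext A
    simp
  rw [Function.comp_apply, ← Finset.mul_sum, ← Nat.cast_sum, ← hsum,
    ← Real.rpow_sum_of_pos (Nat.cast_pos.2 hn)]
  congr 4
  rw [Nat.cast_sum, ← Finset.sum_neg_distrib, Finset.sum_div]

/-! ### Noncrossing partitions and interval partitions -/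

section Noncrossing

variable {α β : Type*}

theorem Setoid.exists_link_of_sup {ρ κ : Setoid α} (P : α → Prop) {x y : α} (h : (ρ ⊔ κ) x y)
    (hx : P x) (hy : ¬P y) :
    ∃ z z', (ρ z z' ∨ κ z z') ∧ (ρ ⊔ κ) x z ∧ P z ∧ ¬P z' := by
  by_contra hcon
  push Not at hcon
  have key : ∀ τ ≤ ρ ⊔ κ, (∀ z z', τ z z' → (ρ z z' ∨ κ z z')) →
      τ ≤ Setoid.ker fun a => (ρ ⊔ κ) x a ∧ P a := by
    intro τ hτ hor a b hab
    refine propext ⟨fun ⟨h1, h2⟩ => ⟨(ρ ⊔ κ).trans h1 (hτ hab), hcon a b (hor _ _ hab) h1 h2⟩,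
      fun ⟨h1, h2⟩ => ?_⟩
    have hba := τ.symm hab
    exact ⟨(ρ ⊔ κ).trans h1 (hτ hba), hcon b a (hor _ _ hba) h1 h2⟩
  have hle := sup_le (key ρ le_sup_left fun _ _ => Or.inl) (key κ le_sup_right fun _ _ => Or.inr)
  have hxy : ((ρ ⊔ κ) x x ∧ P x) = ((ρ ⊔ κ) x y ∧ P y) := hle h
  have := hxy.mp ⟨(ρ ⊔ κ).refl x, hx⟩
  exact hy this.2

variable [LinearOrder α]

/-- A class of `ρ ⊔ ker f` which has points on both sides of an interval `(u, v)` with end points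
in other classes has a link of `ρ` leaving this interval. -/
theorem Setoid.exists_link_leaving [PartialOrder β] {ρ : Setoid α} {f : α → β} (hf : Monotone f)
    {x y u v : α} (h : (ρ ⊔ Setoid.ker f) x y) (hux : u < x) (hxv : x < v) (hy : y < u ∨ v < y)
    (hu : ¬(ρ ⊔ Setoid.ker f) x u) (hv : ¬(ρ ⊔ Setoid.ker f) x v) :
    ∃ z z', (ρ ⊔ Setoid.ker f) x z ∧ ρ z z' ∧ u < z ∧ z < v ∧ (z' < u ∨ v < z') := by
  obtain ⟨z, z', hl, hxz, ⟨h1, h2⟩, h3⟩ := Setoid.exists_link_of_sup (fun z => u < z ∧ z < v) h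
    ⟨hux, hxv⟩ fun ⟨h1, h2⟩ => hy.elim (fun h => h1.not_gt h) fun h => h2.not_gt h
  have hle1 : ρ ≤ ρ ⊔ Setoid.ker f := le_sup_left
  have hle2 : Setoid.ker f ≤ ρ ⊔ Setoid.ker f := le_sup_right
  have hxz' : (ρ ⊔ Setoid.ker f) x z' :=
    (ρ ⊔ Setoid.ker f).trans hxz (hl.elim (fun h => hle1 h) fun h => hle2 h)
  have hz' : z' < u ∨ v < z' := by
    rcases lt_trichotomy z' u with h | rfl | h
    · exact Or.inl h
    · exact absurd hxz' hu
    · rcases lt_trichotomy z' v with h' | rfl | h'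
      · exact absurd ⟨h, h'⟩ h3
      · exact absurd hxz' hv
      · exact Or.inr h'
  refine ⟨z, z', hxz, hl.resolve_right fun hk => ?_, h1, h2, hz'⟩
  have hk : f z = f z' := hk
  rcases hz' with h | h
  · have : f z = f u := le_antisymm (hk.le.trans (hf h.le)) (hf h1.le)
    exact hu ((ρ ⊔ Setoid.ker f).trans hxz (hle2 this))
  · have : f z = f v := le_antisymm (hf h2.le) ((hf h.le).trans hk.ge)
    exact hv ((ρ ⊔ Setoid.ker f).trans hxz (hle2 this))

theorem Setoid.IsNoncrossing.rel_of_link {ρ : Setoid α} (h : ρ.IsNoncrossing) {u v z z' : α}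
    (huv : ρ u v) (hz : ρ z z') (h1 : u < z) (h2 : z < v) (h3 : z' < u ∨ v < z') : ρ u z := by
  rcases h3 with h3 | h3
  · exact ρ.symm (ρ.trans hz (h z' u z v h3 h1 h2 (ρ.symm hz) huv))
  · exact h u z v z' h1 h2 h3 huv hz

/-- The join of a noncrossing partition and a partition into intervals is noncrossing. -/
theorem Setoid.IsNoncrossing.sup_ker [PartialOrder β] {ρ : Setoid α} (h : ρ.IsNoncrossing)
    {f : α → β} (hf : Monotone f) : (ρ ⊔ Setoid.ker f).IsNoncrossing := by
  intro a b c d hab hbc hcd hac hbd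
  have hle : ρ ≤ ρ ⊔ Setoid.ker f := le_sup_left
  set σ := ρ ⊔ Setoid.ker f with hσ
  by_contra hn
  -- A link `y y'` of `ρ` in the class of `b` and `d` leaves `(a, c)`; then a link of `ρ` in the
  -- class of `a` and `c` crosses it.
  obtain ⟨y, y', hby, hyy, h1, h2, h3⟩ := Setoid.exists_link_leaving hf hbd hab hbc (Or.inr hcd)
    (fun h => hn (σ.symm h)) fun h => hn (σ.trans hac (σ.symm h))
  have hay : ¬σ a y := fun h => hn (σ.trans h (σ.symm hby))
  have hay' : ¬σ a y' := fun h => hay (σ.trans h (σ.symm (hle hyy)))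
  rcases h3 with h3 | h3
  · obtain ⟨z, z', haz, hzz, h4, h5, h6⟩ :=
      Setoid.exists_link_leaving hf hac h3 h1 (Or.inr h2) hay' hay
    have := h.rel_of_link (ρ.symm hyy) hzz h4 h5 h6
    exact hay' (σ.trans haz (σ.symm (hle this)))
  · obtain ⟨z, z', haz, hzz, h4, h5, h6⟩ :=
      Setoid.exists_link_leaving hf (σ.symm hac) h2 h3 (Or.inl h1)
        (fun h => hay (σ.trans hac h)) fun h => hay' (σ.trans hac h)
    have := h.rel_of_link hyy hzz h4 h5 h6
    exact hay (σ.trans (σ.trans hac haz) (σ.symm (hle this)))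

theorem Setoid.IsNoncrossing.comap [LinearOrder β] {π : Setoid β} (h : π.IsNoncrossing)
    {f : α → β} (hf : Monotone f) : (π.comap f).IsNoncrossing := by
  intro a b c d hab hbc hcd (hac : π (f a) (f c)) (hbd : π (f b) (f d))
  change π (f a) (f b)
  rcases (hf hab.le).eq_or_lt with h1 | h1
  · rw [h1]
  rcases (hf hbc.le).eq_or_lt with h2 | h2
  · rwa [h2]
  rcases (hf hcd.le).eq_or_lt with h3 | h3
  · rw [h3] at hac
    exact π.trans hac (π.symm hbd)
  exact h _ _ _ _ h1 h2 h3 hac hbd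

theorem Setoid.IsNoncrossing.of_comap [LinearOrder β] {π : Setoid β} {f : α → β}
    (h : (π.comap f).IsNoncrossing) (hf : Monotone f) (hs : Function.Surjective f) :
    π.IsNoncrossing := by
  intro a b c d hab hbc hcd hac hbd
  obtain ⟨a, rfl⟩ := hs a
  obtain ⟨b, rfl⟩ := hs b
  obtain ⟨c, rfl⟩ := hs c
  obtain ⟨d, rfl⟩ := hs d
  exact h a b c d (hf.reflect_lt hab) (hf.reflect_lt hbc) (hf.reflect_lt hcd) hac hbd

end Noncrossing

/-! ### Gluing partitions along the fibres of a map -/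

section Glue

variable {α Q : Type*}

/-- The partition whose restriction to each fibre `g ⁻¹ q` is `τ q`, all of whose classes lie in
such fibres. -/
def Setoid.glue (g : α → Q) (τ : ∀ q, Setoid {x // g x = q}) : Setoid α where
  r x y := ∃ (q : Q) (hx : g x = q) (hy : g y = q), τ q ⟨x, hx⟩ ⟨y, hy⟩
  iseqv :=
    { refl := fun x => ⟨g x, rfl, rfl, (τ _).refl _⟩
      symm := by
        rintro x y ⟨q, hx, hy, h⟩
        exact ⟨q, hy, hx, (τ q).symm h⟩
      trans := by
        rintro x y z ⟨q, hx, hy, h⟩ ⟨q', hy', hz, h'⟩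
        subst hy'
        subst hy
        exact ⟨_, hx, hz, (τ _).trans h h'⟩ }

theorem Setoid.glue_iff (g : α → Q) {τ : ∀ q, Setoid {x // g x = q}} {q : Q} {x y : α}
    (hx : g x = q) (hy : g y = q) : Setoid.glue g τ x y ↔ τ q ⟨x, hx⟩ ⟨y, hy⟩ := by
  refine ⟨fun ⟨q', hx', hy', h⟩ => ?_, fun h => ⟨q, hx, hy, h⟩⟩
  obtain rfl : q' = q := hx'.symm.trans hx
  exact h

theorem Setoid.glue_le_ker (g : α → Q) (τ : ∀ q, Setoid {x // g x = q}) :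
    Setoid.glue g τ ≤ Setoid.ker g := fun _ _ ⟨_, hx, hy, _⟩ => hx.trans hy.symm

theorem Setoid.comap_glue (g : α → Q) (τ : ∀ q, Setoid {x // g x = q}) (q : Q) :
    (Setoid.glue g τ).comap (Subtype.val : {x // g x = q} → α) = τ q :=
  Setoid.ext fun x y => Setoid.glue_iff g x.2 y.2

theorem Setoid.glue_comap {g : α → Q} {ρ : Setoid α} (h : ρ ≤ Setoid.ker g) :
    Setoid.glue g (fun q => ρ.comap (Subtype.val : {x // g x = q} → α)) = ρ :=
  Setoid.ext fun _ y => ⟨fun ⟨_, _, _, h⟩ => h, fun hxy => ⟨g y, h hxy, rfl, hxy⟩⟩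

end Glue

/-! ### Pairings adapted to a map -/

section Pairings

variable {α β : Type*} [LinearOrder α]

/-- The noncrossing pairings which do not link two points with the same image under `f`. For
`f = blockIndex r` this is `NC2 r`. -/
def fiberwisePairings (f : α → β) : Set (Setoid α) :=
  {ρ | ρ.IsNoncrossing ∧ ρ.IsPairing ∧ ρ ⊓ Setoid.ker f = ⊥}

/-- The elements of `fiberwisePairings f` which connect all the fibres of `f`. For
`f = blockIndex r` this is `NC2Star r`. -/
def connectedPairings (f : α → β) : Set (Setoid α) :=
  {ρ | ρ ∈ fiberwisePairings f ∧ ρ ⊔ Setoid.ker f = ⊤}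

theorem Setoid.inf_eq_bot_iff {γ : Type*} {ρ σ : Setoid γ} :
    ρ ⊓ σ = ⊥ ↔ ∀ x y, ρ x y → σ x y → x = y :=
  ⟨fun h x y h1 h2 => by
    have : (ρ ⊓ σ) x y := ⟨h1, h2⟩
    rwa [h] at this, fun h => le_bot_iff.1 fun x y hxy => h x y hxy.1 hxy.2⟩

theorem Setoid.isPairing_comap_iff {γ δ : Type*} {ρ : Setoid δ} {e : γ → δ}
    (he : Function.Injective e) (hr : ∀ x y, ρ (e x) y → y ∈ Set.range e) :
    (ρ.comap e).IsPairing ↔ ∀ x, {y | ρ (e x) y}.ncard = 2 := by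
  refine forall_congr' fun x => ?_
  rw [← Set.ncard_image_of_injective _ he]
  congr! 2
  ext y
  constructor
  · rintro ⟨z, hz, rfl⟩
    exact hz
  · intro hy
    obtain ⟨z, rfl⟩ := hr x y hy
    exact ⟨z, hy, rfl⟩

theorem comap_mem_connectedPairings {α' β' : Type*} [LinearOrder α'] (e : α' ≃o α)
    {g : β' → β} (hg : Function.Injective g) {f : α → β} {f' : α' → β'}
    (h : ∀ x, f (e x) = g (f' x)) {ρ : Setoid α} (hρ : ρ ∈ connectedPairings f) :
    ρ.comap e ∈ connectedPairings f' := by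
  obtain ⟨⟨h1, h2, h3⟩, h4⟩ := hρ
  have hker : Setoid.ker f' = (Setoid.ker f).comap e :=
    Setoid.ext fun x y => by
      rw [Setoid.comap_rel, Setoid.ker_def, Setoid.ker_def, h, h, hg.eq_iff]
  refine ⟨⟨h1.comap e.monotone, ?_, ?_⟩, ?_⟩
  · exact (Setoid.isPairing_comap_iff e.injective fun x y _ => e.surjective y).2 fun x => h2 _
  · rw [Setoid.inf_eq_bot_iff] at h3 ⊢
    intro x y hxy hf
    rw [hker] at hf
    exact e.injective (h3 _ _ hxy hf)
  · have hle : ρ ⊔ Setoid.ker f ≤ (ρ.comap e ⊔ Setoid.ker f').comap e.symm := by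
      refine sup_le (fun x y hxy => ?_) fun x y hxy => ?_
      · exact (le_sup_left : ρ.comap e ≤ ρ.comap e ⊔ Setoid.ker f') (by simpa [Setoid.comap_rel])
      · refine (le_sup_right : Setoid.ker f' ≤ ρ.comap e ⊔ Setoid.ker f') ?_
        rw [hker]
        simpa [Setoid.comap_rel] using hxy
    refine top_le_iff.1 fun x y _ => ?_
    have : (ρ ⊔ Setoid.ker f) (e x) (e y) := by
      rw [h4]
      trivial
    simpa [Setoid.comap_rel] using hle this

theorem ncard_connectedPairings_congr {α' β' : Type*} [LinearOrder α'] [Finite α] (e : α' ≃o α)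
    {g : β' → β} (hg : Function.Injective g) {f : α → β} {f' : α' → β'}
    (h : ∀ x, f (e x) = g (f' x)) :
    (connectedPairings f').ncard = (connectedPairings f).ncard := by
  rw [← Nat.card_coe_set_eq, ← Nat.card_coe_set_eq]
  have h2 : ∀ x, g (f' (e.symm x)) = id (f x) := fun x => by rw [← h]; simp
  -- `g ∘ f'` and `f'` have the same kernel
  have hgf : ∀ ρ ∈ connectedPairings f', ρ ∈ connectedPairings (g ∘ f') := by
    have : Setoid.ker f' = Setoid.ker (g ∘ f') :=
      Setoid.ext fun x y => hg.eq_iff.symm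
    rw [connectedPairings, connectedPairings, fiberwisePairings, fiberwisePairings, this]
    exact fun _ h => h
  refine Nat.card_congr
    { toFun := fun ρ => ⟨ρ.1.comap e.symm,
        comap_mem_connectedPairings e.symm (f := g ∘ f') Function.injective_id h2 (hgf ρ.1 ρ.2)⟩
      invFun := fun ρ => ⟨ρ.1.comap e, comap_mem_connectedPairings e hg h ρ.2⟩
      left_inv := fun ρ => ?_
      right_inv := fun ρ => ?_ }
  · refine Subtype.ext (Setoid.ext fun x y => ?_)
    simp [Setoid.comap_rel]
  · refine Subtype.ext (Setoid.ext fun x y => ?_)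
    simp [Setoid.comap_rel]

/-- Monotone maps with fibres of the same cardinalities differ by an order isomorphism. -/
theorem exists_orderIso_of_card_fiber {α' : Type*} [LinearOrder α'] [Finite α] [Finite α']
    [PartialOrder β] {f : α → β} {f' : α' → β} (hf : Monotone f) (hf' : Monotone f')
    (h : ∀ b, Nat.card {x // f' x = b} = Nat.card {x // f x = b}) :
    ∃ e : α' ≃o α, ∀ x, f (e x) = f' x := by
  have := Fintype.ofFinite α
  have := Fintype.ofFinite α'
  classical
  have hiso : ∀ b, Nonempty ({x // f' x = b} ≃o {x // f x = b}) := fun b =>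
    ⟨((Fintype.orderIsoFinOfCardEq _ rfl).symm.trans
      (Fintype.orderIsoFinOfCardEq _ (by
        rw [← Nat.card_eq_fintype_card, ← Nat.card_eq_fintype_card, h])))⟩
  let e : ∀ b, {x // f' x = b} ≃o {x // f x = b} := fun b => (hiso b).some
  have hval : ∀ b (x : α') (hx : f' x = b),
      Equiv.ofFiberEquiv (fun b => (e b).toEquiv) x = (e b ⟨x, hx⟩ : α) := by
    rintro _ x rfl
    rfl
  have hmap : ∀ x, f (Equiv.ofFiberEquiv (fun b => (e b).toEquiv) x) = f' x :=
    Equiv.ofFiberEquiv_map _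
  have hmono : StrictMono (Equiv.ofFiberEquiv fun b => (e b).toEquiv) := by
    intro x y hxy
    rcases (hf' hxy.le).eq_or_lt with h | h
    · rw [hval _ x h, hval _ y rfl]
      exact (e (f' y)).strictMono (a := ⟨x, h⟩) (b := ⟨y, rfl⟩) hxy
    · rw [← hmap, ← hmap] at h
      exact hf.reflect_lt h
  exact ⟨hmono.orderIsoOfSurjective _ (Equiv.surjective _), hmap⟩

/-! ### Decomposing a pairing along the blocks of its join with the fibres -/

/-- The restriction of `f` to the preimage of a class `q` of a partition of its target. -/
def restrictClass (f : α → β) (π : Setoid β) (q : Quotient π) :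
    {x // Quotient.mk π (f x) = q} → β := fun x => f x

/-- The pairings whose join with the fibres of `f` is the partition `π` of the fibres: they
correspond to families of connected pairings, one on each block of `π`. -/
theorem bijOn_glue [LinearOrder β] {f : α → β} (hf : Monotone f) {π : Setoid β}
    (hπ : π.IsNoncrossing) :
    Set.BijOn (Setoid.glue fun x => Quotient.mk π (f x))
      {τ | ∀ q, τ q ∈ connectedPairings (restrictClass f π q)}
      {ρ | ρ ∈ fiberwisePairings f ∧ ρ ⊔ Setoid.ker f = π.comap f} := by
  have hker : Setoid.ker (fun x => Quotient.mk π (f x)) = π.comap f :=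
    Setoid.ext fun x y => Quotient.eq
  have hcomap := hπ.comap hf
  refine ⟨fun τ hτ => ⟨⟨?_, ?_, ?_⟩, ?_⟩, fun τ _ τ' _ h => ?_, fun ρ hρ => ?_⟩
  · intro a b c d hab hbc hcd hac hbd
    have hle := Setoid.glue_le_ker _ τ
    have h1 : Quotient.mk π (f a) = Quotient.mk π (f c) := hle hac
    have h2 : Quotient.mk π (f b) = Quotient.mk π (f d) := hle hbd
    have h3 : Quotient.mk π (f a) = Quotient.mk π (f b) :=
      Quotient.sound (hcomap a b c d hab hbc hcd (Quotient.exact (s := π) h1)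
        (Quotient.exact (s := π) h2))
    rw [Setoid.glue_iff (fun x => Quotient.mk π (f x)) h3 rfl]
    rw [Setoid.glue_iff (fun x => Quotient.mk π (f x)) h3 (h1.symm.trans h3)] at hac
    rw [Setoid.glue_iff (fun x => Quotient.mk π (f x)) rfl h2.symm] at hbd
    exact (hτ _).1.1 _ _ _ _ (Subtype.mk_lt_mk.2 hab) (Subtype.mk_lt_mk.2 hbc)
      (Subtype.mk_lt_mk.2 hcd) hac hbd
  · intro a
    have h := (hτ (Quotient.mk π (f a))).1.2.1
    rw [← Setoid.comap_glue (fun x => Quotient.mk π (f x)) τ,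
      Setoid.isPairing_comap_iff Subtype.val_injective] at h
    · exact h ⟨a, rfl⟩
    · intro x y hxy
      exact ⟨⟨y, (Setoid.glue_le_ker _ _ hxy).symm.trans x.2⟩, rfl⟩
  · rw [Setoid.inf_eq_bot_iff]
    rintro x y ⟨q, hx, hy, h⟩ hxy
    exact congrArg Subtype.val (Setoid.inf_eq_bot_iff.1 (hτ q).1.2.2 _ _ h hxy)
  · refine le_antisymm (sup_le ?_ fun x y (hxy : f x = f y) => ?_) fun x y hxy => ?_
    · rw [← hker]
      exact Setoid.glue_le_ker _ _
    · change π (f x) (f y)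
      rw [hxy]
    · have hq : Quotient.mk π (f x) = Quotient.mk π (f y) := Quotient.sound hxy
      have htop : (τ (Quotient.mk π (f y)) ⊔ Setoid.ker (restrictClass f π (Quotient.mk π (f y))))
          ⟨x, hq⟩ ⟨y, rfl⟩ := by
        rw [(hτ _).2]
        trivial
      have hle : τ (Quotient.mk π (f y)) ⊔ Setoid.ker (restrictClass f π (Quotient.mk π (f y))) ≤
          (Setoid.glue (fun x => Quotient.mk π (f x)) τ ⊔ Setoid.ker f).comap Subtype.val := by
        refine sup_le (fun u v huv => ?_) fun u v huv => ?_
        · exact (le_sup_left : _ ≤ Setoid.glue (fun x => Quotient.mk π (f x)) τ ⊔ Setoid.ker f)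
            ((Setoid.glue_iff (fun x => Quotient.mk π (f x)) u.2 v.2).2 huv)
        · exact (le_sup_right : _ ≤ Setoid.glue (fun x => Quotient.mk π (f x)) τ ⊔ Setoid.ker f)
            huv
      exact hle htop
  · funext q
    rw [← Setoid.comap_glue _ τ q, h, Setoid.comap_glue]
  · obtain ⟨⟨h1, h2, h3⟩, h4⟩ := hρ
    have hle : ρ ≤ Setoid.ker fun x => Quotient.mk π (f x) := by
      rw [hker, ← h4]
      exact le_sup_left
    refine ⟨fun q => ρ.comap Subtype.val, fun q => ⟨⟨?_, ?_, ?_⟩, ?_⟩, Setoid.glue_comap hle⟩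
    · exact h1.comap (Subtype.mono_coe _)
    · refine (Setoid.isPairing_comap_iff Subtype.val_injective fun x y hxy => ?_).2 fun x => h2 x
      exact ⟨⟨y, (hle hxy).symm.trans x.2⟩, rfl⟩
    · rw [Setoid.inf_eq_bot_iff] at h3 ⊢
      exact fun x y hxy hf => Subtype.ext (h3 _ _ hxy hf)
    · have hsup : ρ ⊔ Setoid.ker f ≤ Setoid.glue (fun x => Quotient.mk π (f x)) fun q =>
          ρ.comap Subtype.val ⊔ Setoid.ker (restrictClass f π q) := by
        refine sup_le (fun x y hxy => ⟨_, hle hxy, rfl, ?_⟩) fun x y (hxy : f x = f y) =>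
          ⟨Quotient.mk π (f y), congrArg _ hxy, rfl, ?_⟩
        · exact (le_sup_left : ρ.comap Subtype.val ≤ ρ.comap Subtype.val ⊔
            Setoid.ker (restrictClass f π (Quotient.mk π (f y)))) hxy
        · exact (le_sup_right : Setoid.ker (restrictClass f π (Quotient.mk π (f y))) ≤
            ρ.comap Subtype.val ⊔ _) hxy
      refine top_le_iff.1 fun x y _ => ?_
      have hxy : (ρ ⊔ Setoid.ker f) x y := by
        rw [h4]
        exact Quotient.exact (s := π) (x.2.trans y.2.symm)
      exact (Setoid.glue_iff (fun x => Quotient.mk π (f x)) x.2 y.2).1 (hsup hxy)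

theorem exists_isNoncrossing_sup_ker [LinearOrder β] {f : α → β} (hf : Monotone f)
    (hs : Function.Surjective f) {ρ : Setoid α} (hρ : ρ.IsNoncrossing) :
    ∃ π : Setoid β, π.IsNoncrossing ∧ ρ ⊔ Setoid.ker f = π.comap f := by
  have h : ρ ⊔ Setoid.ker f =
      ((ρ ⊔ Setoid.ker f).mapOfSurjective f le_sup_right hs).comap f := by
    refine Setoid.ext fun x y => ⟨fun h => ⟨x, y, h, rfl, rfl⟩, ?_⟩
    rintro ⟨x', y', h, hx, hy⟩
    have hle : Setoid.ker f ≤ ρ ⊔ Setoid.ker f := le_sup_right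
    exact (ρ ⊔ Setoid.ker f).trans (hle hx.symm) ((ρ ⊔ Setoid.ker f).trans h (hle hy))
  exact ⟨_, (h ▸ hρ.sup_ker hf : Setoid.IsNoncrossing (Setoid.comap f _)).of_comap hf hs, h⟩

theorem Setoid.comap_injective_of_surjective {γ δ : Type*} {f : γ → δ}
    (hs : Function.Surjective f) : Function.Injective (Setoid.comap f) := by
  refine fun π π' h => Setoid.ext fun x y => ?_
  obtain ⟨x, rfl⟩ := hs x
  obtain ⟨y, rfl⟩ := hs y
  rw [← Setoid.comap_rel, h, Setoid.comap_rel]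

open Classical in
theorem ncard_fiberwisePairings [Finite α] [LinearOrder β] [Fintype (Setoid β)] {f : α → β}
    (hf : Monotone f) (hs : Function.Surjective f) :
    (fiberwisePairings f).ncard = ∑ π : {π : Setoid β // π.IsNoncrossing},
      {ρ | ρ ∈ fiberwisePairings f ∧ ρ ⊔ Setoid.ker f = π.1.comap f}.ncard := by
  have : Finite (Setoid α) := Finite.of_injective (fun (π : Setoid α) (a b : α) => π a b)
    fun π ρ h => Setoid.ext fun a b => iff_of_eq (congrFun (congrFun h a) b)
  simp_rw [← Nat.card_coe_set_eq]
  rw [← Nat.card_sigma]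
  refine (Nat.card_congr (Equiv.ofBijective
    (fun s : (π : {π : Setoid β // π.IsNoncrossing}) × _ =>
      (⟨s.2.1, s.2.2.1⟩ : fiberwisePairings f)) ⟨?_, ?_⟩)).symm
  · rintro ⟨π, ρ, h1, h2⟩ ⟨π', ρ', h1', h2'⟩ h
    obtain rfl : ρ = ρ' := congrArg Subtype.val h
    obtain rfl : π = π' :=
      Subtype.ext (Setoid.comap_injective_of_surjective hs (h2.symm.trans h2'))
    rfl
  · rintro ⟨ρ, hρ⟩
    obtain ⟨π, hπ, h⟩ := exists_isNoncrossing_sup_ker hf hs hρ.1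
    exact ⟨⟨⟨π, hπ⟩, ρ, hρ, h⟩, rfl⟩

theorem ncard_fiberwisePairings_sup_eq [Finite α] [LinearOrder β] {f : α → β} (hf : Monotone f)
    {π : Setoid β} [Fintype (Quotient π)] (hπ : π.IsNoncrossing) :
    {ρ | ρ ∈ fiberwisePairings f ∧ ρ ⊔ Setoid.ker f = π.comap f}.ncard =
      ∏ q : Quotient π, (connectedPairings (restrictClass f π q)).ncard := by
  rw [← (bijOn_glue hf hπ).image_eq, (bijOn_glue hf hπ).injOn.ncard_image]
  simp_rw [← Nat.card_coe_set_eq]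
  rw [← Nat.card_pi]
  exact Nat.card_congr
    { toFun := fun τ q => ⟨τ.1 q, τ.2 q⟩
      invFun := fun τ => ⟨fun q => (τ q).1, fun q => (τ q).2⟩
      left_inv := fun _ => rfl
      right_inv := fun _ => rfl }

end Pairings

/-! ### Moments and cumulants of the limit -/

theorem NC2_eq_fiberwisePairings {p : ℕ} (r : Fin p → ℕ+) :
    NC2 r = fiberwisePairings (blockIndex r) := rfl

theorem NC2Star_eq_connectedPairings {p : ℕ} (r : Fin p → ℕ+) :
    NC2Star r = connectedPairings (blockIndex r) := rfl

theorem card_blockIndex_fiber {p : ℕ} (r : Fin p → ℕ+) (i : Fin p) :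
    Nat.card {x // blockIndex r x = i} = r i := by
  have e : {x // blockIndex r x = i} ≃ Fin (r i) :=
    { toFun := fun x => Fin.cast (congrArg (fun i => (r i : ℕ)) x.2) (finSigmaFinEquiv.symm x.1).2
      invFun := fun x => ⟨finSigmaFinEquiv ⟨i, x⟩, blockIndex_finSigmaFinEquiv r i x⟩
      left_inv := by
        rintro ⟨x, rfl⟩
        exact Subtype.ext (finSigmaFinEquiv.apply_symm_apply x)
      right_inv := fun x => by
        refine Fin.ext ?_
        exact apply_symm_finSigmaFinEquiv (r := fun i => (r i : ℕ)) (fun i j => (j : ℕ)) i x }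
  rw [Nat.card_congr e, Nat.card_fin]

/-- On a block of a partition of the intervals, the connected pairings are those attached to the
lengths of the intervals of the block. -/
theorem ncard_connectedPairings_restrictClass {p : ℕ} (r : Fin p → ℕ+) (π : Setoid (Fin p))
    (q : Quotient π) :
    (connectedPairings (restrictClass (blockIndex r) π q)).ncard =
      (NC2Star fun i => r ((partitionBlock π q).orderEmbOfFin rfl i)).ncard := by
  rw [NC2Star_eq_connectedPairings]
  set V := partitionBlock π q with hV
  set ε := V.orderEmbOfFin rfl with hε
  have hmem : ∀ b, b ∈ V ↔ Quotient.mk π b = q := fun b => by simp [hV, partitionBlock]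
  have hmono : Monotone (restrictClass (blockIndex r) π q) := fun x y hxy =>
    blockIndex_monotone r hxy
  have hmono' : Monotone fun x => ε (blockIndex (fun i => r (ε i)) x) :=
    ε.monotone.comp (blockIndex_monotone _)
  obtain ⟨e, he⟩ := exists_orderIso_of_card_fiber hmono hmono' fun b => by
    by_cases hb : b ∈ V
    · obtain ⟨k, rfl⟩ : ∃ k, ε k = b := by
        have : b ∈ Set.range ε := by rw [hε, Finset.range_orderEmbOfFin]; exact hb
        exact this
      rw [Nat.card_congr (Equiv.subtypeEquivRight fun x => ε.injective.eq_iff),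
        card_blockIndex_fiber, ← card_blockIndex_fiber r (ε k)]
      exact Nat.card_congr
        { toFun := fun x => ⟨⟨x.1, by rw [x.2]; exact (hmem _).1 hb⟩, x.2⟩
          invFun := fun x => ⟨x.1.1, x.2⟩
          left_inv := fun _ => rfl
          right_inv := fun _ => rfl }
    · have h1 : IsEmpty {x // ε (blockIndex (fun i => r (ε i)) x) = b} :=
        ⟨fun x => hb (by rw [← x.2]; exact Finset.orderEmbOfFin_mem V rfl _)⟩
      have h2 : IsEmpty {x // restrictClass (blockIndex r) π q x = b} :=
        ⟨fun x => hb ((hmem b).2 (by rw [← x.2]; exact x.1.2))⟩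
      rw [Nat.card_of_isEmpty, Nat.card_of_isEmpty]
  exact (ncard_connectedPairings_congr e ε.injective he).symm

open Classical in
/-- The numbers of noncrossing pairings satisfy the moment-cumulant formula, with the numbers of
connected ones as cumulants. -/
theorem ncard_NC2_eq {p : ℕ} (r : Fin p → ℕ+) :
    (NC2 r).ncard = (NC2Star r).ncard +
      ∑ π : {π : Setoid (Fin p) // π.IsNoncrossing ∧ π ≠ ⊤}, ∏ q : Quotient π.1,
        (NC2Star fun i => r ((partitionBlock π.1 q).orderEmbOfFin rfl i)).ncard := by
  have htop : (⊤ : Setoid (Fin p)).IsNoncrossing := fun _ _ _ _ _ _ _ _ _ => trivial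
  rw [NC2_eq_fiberwisePairings,
    ncard_fiberwisePairings (blockIndex_monotone r) (blockIndex_surjective r),
    ← Fintype.sum_subtype_add_sum_subtype
      (fun π : {π : Setoid (Fin p) // π.IsNoncrossing} => π.1 = ⊤)]
  congr 1
  · rw [Fintype.sum_eq_single ⟨⟨⊤, htop⟩, rfl⟩]
    · rfl
    · rintro ⟨⟨π, h⟩, h'⟩ hne
      exact absurd (Subtype.ext (Subtype.ext h')) hne
  · refine Fintype.sum_equiv (Equiv.subtypeSubtypeEquivSubtypeInter _ fun π => π ≠ ⊤) _ _ ?_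
    rintro ⟨⟨π, h⟩, h'⟩
    rw [ncard_fiberwisePairings_sup_eq (blockIndex_monotone r) h]
    exact Finset.prod_congr rfl fun q _ => ncard_connectedPairings_restrictClass r π q

theorem card_partitionBlock_pos {n : ℕ} (π : Setoid (Fin n)) (q : Quotient π) :
    1 ≤ (partitionBlock π q).card := by
  obtain ⟨i, hi⟩ := Quotient.exists_rep q
  exact Finset.card_pos.2 ⟨i, by simp [partitionBlock, hi]⟩

/-- The moments are the numbers of noncrossing pairings if and only if the free cumulants are the
numbers of connected noncrossing pairings. -/
theorem moments_iff_freeCumulants {A : Type*} [Ring A] [Algebra ℂ A] (φ : A →ₗ[ℂ] ℂ)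
    (M : ℕ+ → A) :
    (∀ (p : ℕ) (r : Fin p → ℕ+), 1 ≤ p →
        φ (List.ofFn fun i => M (r i)).prod = ((NC2 r).ncard : ℂ)) ↔
      ∀ (p : ℕ) (r : Fin p → ℕ+), 1 ≤ p →
        freeCumulant φ p (fun i => M (r i)) = ((NC2Star r).ncard : ℂ) := by
  constructor
  · intro h p
    induction p using Nat.strong_induction_on with
    | _ p ih =>
    intro r hp
    rw [freeCumulant, h p r hp, ncard_NC2_eq, Nat.cast_add, sub_eq_iff_eq_add, Nat.cast_sum]
    congr 1
    refine Finset.sum_congr rfl fun π _ => ?_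
    rw [Nat.cast_prod]
    refine Finset.prod_congr rfl fun q _ => (ih _ (card_partitionBlock_lt π.2.2 q)
      (fun i => r ((partitionBlock π.1 q).orderEmbOfFin rfl i)) (card_partitionBlock_pos _ q)).symm
  · intro h p r hp
    have hk := h p r hp
    rw [freeCumulant, sub_eq_iff_eq_add] at hk
    rw [hk, ncard_NC2_eq, Nat.cast_add, Nat.cast_sum]
    congr 1
    refine Finset.sum_congr rfl fun π _ => ?_
    rw [Nat.cast_prod]
    exact Finset.prod_congr rfl fun q _ => h _
      (fun i => r ((partitionBlock π.1 q).orderEmbOfFin rfl i)) (card_partitionBlock_pos _ q)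

/-! ### The star operation of a monoid algebra -/

section MonoidAlgebraStar

variable {R G : Type*} [CommSemiring R] [StarRing R] [Monoid G] [StarMul G]

/-- The conjugate-linear extension of the involution of a monoid to its monoid algebra. -/
noncomputable instance MonoidAlgebra.instStar : Star (MonoidAlgebra R G) where
  star x := .ofCoeff ((x.coeff.equivMapDomain (star_involutive (R := G)).toPerm).mapRange star
    (star_zero R))

theorem MonoidAlgebra.coeff_star (x : MonoidAlgebra R G) (g : G) :
    (star x).coeff g = star (x.coeff (star g)) := rfl

theorem MonoidAlgebra.star_add' (x y : MonoidAlgebra R G) : star (x + y) = star x + star y := by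
  ext g
  simp [MonoidAlgebra.coeff_star]

theorem MonoidAlgebra.star_single (g : G) (c : R) :
    star (MonoidAlgebra.single g c) = MonoidAlgebra.single (star g) (star c) := by
  classical
  ext h
  rw [MonoidAlgebra.coeff_star, MonoidAlgebra.coeff_single, MonoidAlgebra.coeff_single,
    Finsupp.single_apply, Finsupp.single_apply, apply_ite star, star_zero]
  have h' : g = star h ↔ star g = h :=
    ⟨fun e => by rw [e, star_star], fun e => by rw [← e, star_star]⟩
  simp only [h']

noncomputable instance MonoidAlgebra.instStarRing : StarRing (MonoidAlgebra R G) where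
  star_involutive x := by
    ext g
    simp [MonoidAlgebra.coeff_star]
  star_add := MonoidAlgebra.star_add'
  star_mul x y := by
    have h0 : star (0 : MonoidAlgebra R G) = 0 := by
      ext g
      simp [MonoidAlgebra.coeff_star]
    induction x using MonoidAlgebra.induction_linear with
    | zero => simp [h0]
    | add x x' h h' =>
      rw [add_mul, MonoidAlgebra.star_add', MonoidAlgebra.star_add', h, h', mul_add]
    | single g c =>
      induction y using MonoidAlgebra.induction_linear with
      | zero => simp [h0]
      | add y y' h h' =>
        rw [mul_add, MonoidAlgebra.star_add', MonoidAlgebra.star_add', h, h', add_mul]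
      | single g' c' =>
        rw [MonoidAlgebra.single_mul_single, MonoidAlgebra.star_single, MonoidAlgebra.star_single,
          MonoidAlgebra.star_single, MonoidAlgebra.single_mul_single, star_mul, star_mul]

instance MonoidAlgebra.instStarModule : StarModule R (MonoidAlgebra R G) where
  star_smul c x := by
    ext g
    simp [MonoidAlgebra.coeff_star]

end MonoidAlgebraStar

instance FinitaryPerm.instStarMul : StarMul FinitaryPerm where
  star := fun σ => σ⁻¹
  star_involutive := inv_inv
  star_mul := mul_inv_rev

theorem FinitaryPerm.star_def (σ : FinitaryPerm) : star σ = σ⁻¹ := rfl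

theorem groupTrace_apply {G : Type*} [Group G] (x : MonoidAlgebra ℂ G) :
    groupTrace G x = x.coeff 1 := rfl

theorem isState_groupTrace_finitaryPerm : IsState (groupTrace FinitaryPerm) where
  map_one := by simp [groupTrace_apply, MonoidAlgebra.one_def]
  map_star x := by
    rw [groupTrace_apply, groupTrace_apply, MonoidAlgebra.coeff_star, star_one]
    rfl
  nonneg x := by
    rw [groupTrace_apply, MonoidAlgebra.coeff_mul_apply_left]
    refine Finset.sum_nonneg fun g _ => ?_
    dsimp only
    rw [MonoidAlgebra.coeff_star, mul_one, FinitaryPerm.star_def, inv_inv]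
    exact mul_star_self_nonneg _

theorem isSelfAdjoint_permModel (r n : ℕ) : IsSelfAdjoint (permModel r n 1) := by
  have hn : ⌊(n : ℝ) * 1⌋₊ = n := by simp
  have hrev : ∀ a : Fin r → ℕ, star (List.ofFn fun i => starTransposition (a i)).prod =
      (List.ofFn fun i => starTransposition (a (Fin.rev i))).prod := by
    intro a
    have hr : List.ofFn (fun i => starTransposition (a (Fin.rev i))) =
        (List.ofFn fun i => starTransposition (a i)).reverse := by
      refine List.ext_getElem (by simp) fun i h1 h2 => ?_
      simp [Fin.rev, Nat.sub_sub, Nat.add_comm]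
    rw [hr, FinitaryPerm.star_def, List.prod_inv_reverse, List.map_ofFn]
    congr 2
  -- Term by term, the adjoint of the expansion into star transpositions is the expansion into
  -- cycles.
  rw [IsSelfAdjoint, permModel_eq, star_smul, star_sum]
  rw [← permModel_eq, permModel, hn]
  congr 1
  · exact Complex.conj_ofReal _
  · refine Finset.sum_congr rfl fun a _ => ?_
    rw [MonoidAlgebra.of_apply, MonoidAlgebra.star_single, star_one, hrev (fun i => (a i : ℕ)),
      MonoidAlgebra.of_apply, zeroCycle_eq_prod]
    · exact Subtype.val_injective.comp a.injective
    · intro i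
      have := (Finset.mem_Icc.1 (a i).2).1
      omega

/-! ### Convergence in distribution and words -/

theorem lift_equivMonoidAlgebra_symm_single {A X : Type*} [Ring A] [Algebra ℂ A] (x : X → A)
    (w : FreeMonoid X) (c : ℂ) :
    FreeAlgebra.lift ℂ x (FreeAlgebra.equivMonoidAlgebraFreeMonoid.symm
      (MonoidAlgebra.single w c)) = c • (w.toList.map x).prod := by
  have : FreeAlgebra.equivMonoidAlgebraFreeMonoid.symm (MonoidAlgebra.single w c) =
      c • FreeMonoid.lift (FreeAlgebra.ι ℂ) w :=
    MonoidAlgebra.lift_single _ _ _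
  rw [this, map_smul, FreeMonoid.lift_apply, map_list_prod, List.map_map]
  congr 3
  funext i
  simp

/-- Convergence in distribution may be tested on words. -/
theorem convergesInDistribution_of_words {A B X : Type*} [Ring A] [Algebra ℂ A] [Ring B]
    [Algebra ℂ B] (ψ : B →ₗ[ℂ] ℂ) (x : ℕ → X → B) (φ : A →ₗ[ℂ] ℂ) (y : X → A)
    (h : ∀ l : List X, Tendsto (fun n => ψ (l.map (x n)).prod) atTop (𝓝 (φ (l.map y).prod))) :
    ConvergesInDistribution ψ x φ y := by
  intro P
  obtain ⟨P, rfl⟩ := FreeAlgebra.equivMonoidAlgebraFreeMonoid.symm.surjective P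
  induction P using MonoidAlgebra.induction_linear with
  | zero => simp
  | add P Q hP hQ => simpa using hP.add hQ
  | single w c =>
    simp only [ncDistribution, LinearMap.comp_apply, AlgHom.toLinearMap_apply,
      lift_equivMonoidAlgebra_symm_single, map_smul]
    exact (h w.toList).const_smul c

theorem tendsto_groupTrace_word (l : List ℕ+) :
    Tendsto (fun n : ℕ => groupTrace FinitaryPerm (l.map fun r : ℕ+ => permModel r n 1).prod) atTop
      (𝓝 ((NC2 l.get).ncard : ℂ)) := by
  have h := tendsto_groupTrace_prod_permModel l.get
  refine h.congr fun n => ?_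
  congr 2
  conv_rhs => rw [← List.ofFn_get l, List.map_ofFn]
  rfl

/-- The limit distribution is characterized by its moments. -/
theorem isLimitFamily_iff_moments {A : Type*} [Ring A] [Algebra ℂ A] (φ : A →ₗ[ℂ] ℂ)
    (h1 : φ 1 = 1) (M : ℕ+ → A) :
    IsLimitFamily φ M ↔ ∀ (p : ℕ) (r : Fin p → ℕ+), 1 ≤ p →
      φ (List.ofFn fun i => M (r i)).prod = ((NC2 r).ncard : ℂ) := by
  constructor
  · intro h p r _
    have hP := h (List.ofFn fun i => FreeAlgebra.ι ℂ (r i)).prod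
    simp only [ncDistribution, LinearMap.comp_apply, AlgHom.toLinearMap_apply, map_list_prod,
      List.map_ofFn, Function.comp_def, FreeAlgebra.lift_ι_apply] at hP
    exact tendsto_nhds_unique hP (tendsto_groupTrace_prod_permModel r)
  · intro h
    refine convergesInDistribution_of_words _ _ _ _ fun l => ?_
    rcases l.eq_nil_or_concat with rfl | hl
    · simp [h1, isState_groupTrace_finitaryPerm.map_one]
    · have hpos : 1 ≤ l.length := by
        obtain ⟨l', a, rfl⟩ := hl
        simp
      have hm := h l.length l.get hpos
      have hl : (List.ofFn fun i => M (l.get i)) = l.map M := by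
        conv_rhs => rw [← List.ofFn_get l, List.map_ofFn]
        rfl
      rw [hl] at hm
      rw [hm]
      exact tendsto_groupTrace_word l

/-! ### Existence of the limit -/

/-- The limit state on the algebra of noncommutative polynomials in the variables `M_r`, realized
as the monoid algebra of the free monoid, whose star operation is conjugate-linear and reverses
words. -/
noncomputable def limitState : MonoidAlgebra ℂ (FreeMonoid ℕ+) →ₗ[ℂ] ℂ :=
  Finsupp.linearCombination ℂ (fun w : FreeMonoid ℕ+ => ((NC2 w.toList.get).ncard : ℂ)) ∘ₗ
    (MonoidAlgebra.coeffLinearEquiv ℂ).toLinearMap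

/-- The variables of the algebra of noncommutative polynomials. -/
noncomputable def limitVariable (r : ℕ+) : MonoidAlgebra ℂ (FreeMonoid ℕ+) :=
  MonoidAlgebra.of ℂ (FreeMonoid ℕ+) (FreeMonoid.of r)

theorem isSelfAdjoint_limitVariable (r : ℕ+) : IsSelfAdjoint (limitVariable r) := by
  rw [IsSelfAdjoint, limitVariable, MonoidAlgebra.of_apply, MonoidAlgebra.star_single, star_one,
    FreeMonoid.star_of]

theorem prod_limitVariable (l : List ℕ+) :
    (l.map limitVariable).prod = MonoidAlgebra.single (FreeMonoid.ofList l) 1 := by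
  have : l.map limitVariable =
      (l.map FreeMonoid.of).map (MonoidAlgebra.of ℂ (FreeMonoid ℕ+)) := by
    rw [List.map_map]
    rfl
  rw [this, ← map_list_prod, MonoidAlgebra.of_apply]
  congr 1
  clear this
  induction l with
  | nil => rfl
  | cons r l ih => rw [List.map_cons, List.prod_cons, ih, ← FreeMonoid.ofList_cons]

theorem isLimitFamily_limitState : IsLimitFamily limitState limitVariable := by
  refine convergesInDistribution_of_words _ _ _ _ fun l => ?_
  have : limitState (l.map limitVariable).prod = ((NC2 l.get).ncard : ℂ) := by
    rw [prod_limitVariable]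
    change Finsupp.linearCombination ℂ _ (Finsupp.single (FreeMonoid.ofList l) (1 : ℂ)) = _
    rw [Finsupp.linearCombination_single, one_smul]
    rfl
  rw [this]
  exact tendsto_groupTrace_word l

/-- The evaluation of noncommutative polynomials at the family `(M_r(n))`. -/
noncomputable def evalPermModel (n : ℕ) :
    MonoidAlgebra ℂ (FreeMonoid ℕ+) →ₐ[ℂ] MonoidAlgebra ℂ FinitaryPerm :=
  MonoidAlgebra.lift ℂ _ _ (FreeMonoid.lift fun r : ℕ+ => permModel r n 1)

theorem evalPermModel_star (n : ℕ) (x : MonoidAlgebra ℂ (FreeMonoid ℕ+)) :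
    evalPermModel n (star x) = star (evalPermModel n x) := by
  induction x using MonoidAlgebra.induction_linear with
  | zero => simp
  | add x y hx hy => rw [star_add, map_add, map_add, star_add, hx, hy]
  | single w c =>
    rw [MonoidAlgebra.star_single, evalPermModel, MonoidAlgebra.lift_single,
      MonoidAlgebra.lift_single, star_smul]
    congr 1
    induction w using FreeMonoid.inductionOn with
    | one => simp
    | of r =>
      rw [FreeMonoid.star_of, FreeMonoid.lift_eval_of]
      exact (isSelfAdjoint_permModel r n).symm
    | mul u v hu hv => rw [star_mul, map_mul, map_mul, star_mul, hu, hv]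

theorem tendsto_groupTrace_evalPermModel (x : MonoidAlgebra ℂ (FreeMonoid ℕ+)) :
    Tendsto (fun n => groupTrace FinitaryPerm (evalPermModel n x)) atTop (𝓝 (limitState x)) := by
  have h := isLimitFamily_limitState (FreeAlgebra.equivMonoidAlgebraFreeMonoid.symm x)
  have hlift : ∀ n, FreeAlgebra.lift ℂ (fun r : ℕ+ => permModel r n 1) =
      (evalPermModel n).comp FreeAlgebra.equivMonoidAlgebraFreeMonoid.toAlgHom := fun n => by
    ext r
    simp [evalPermModel, FreeAlgebra.equivMonoidAlgebraFreeMonoid]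
  have hvar : FreeAlgebra.lift ℂ limitVariable =
      FreeAlgebra.equivMonoidAlgebraFreeMonoid.toAlgHom := rfl
  simpa [ncDistribution, hlift, hvar] using h

/-- The limit of the states given by the canonical trace is a state. -/
theorem isState_limitState : IsState limitState where
  map_one := by
    refine tendsto_nhds_unique (tendsto_groupTrace_evalPermModel 1) ?_
    simp [isState_groupTrace_finitaryPerm.map_one]
  map_star x := by
    refine tendsto_nhds_unique (tendsto_groupTrace_evalPermModel (star x)) ?_
    simp_rw [evalPermModel_star, isState_groupTrace_finitaryPerm.map_star]
    exact (Complex.continuous_conj.tendsto _).comp (tendsto_groupTrace_evalPermModel x)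
  nonneg x := by
    refine ge_of_tendsto' (tendsto_groupTrace_evalPermModel (x * star x)) fun n => ?_
    rw [map_mul, evalPermModel_star]
    exact isState_groupTrace_finitaryPerm.nonneg _

theorem theorem2 :
    (∃ (A : Type) (_ : Ring A) (_ : StarRing A) (_ : Algebra ℂ A) (_ : StarModule ℂ A)
      (φ : A →ₗ[ℂ] ℂ) (M : ℕ+ → A),
      IsState φ ∧ (∀ r, IsSelfAdjoint (M r)) ∧ IsLimitFamily φ M) ∧
    ∀ (A : Type*) [Ring A] [StarRing A] [Algebra ℂ A] [StarModule ℂ A]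
      (φ : A →ₗ[ℂ] ℂ) (M : ℕ+ → A), IsState φ → (∀ r, IsSelfAdjoint (M r)) →
      (IsLimitFamily φ M ↔
        ∀ (p : ℕ) (r : Fin p → ℕ+), 1 ≤ p →
          φ (List.ofFn fun i => M (r i)).prod = ((NC2 r).ncard : ℂ)) ∧
      (IsLimitFamily φ M ↔
        ∀ (p : ℕ) (r : Fin p → ℕ+), 1 ≤ p →
          freeCumulant φ p (fun i => M (r i)) = ((NC2Star r).ncard : ℂ)) := by
  refine ⟨⟨MonoidAlgebra ℂ (FreeMonoid ℕ+), inferInstance, inferInstance, inferInstance,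
    inferInstance, limitState, limitVariable, isState_limitState, isSelfAdjoint_limitVariable,
    isLimitFamily_limitState⟩, ?_⟩
  intro A _ _ _ _ φ M hφ _
  have h := isLimitFamily_iff_moments φ hφ.map_one M
  exact ⟨h, h.trans (moments_iff_freeCumulants φ M)⟩
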